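/- Let $\mathcal X\subset\mathbb R^d$ be compact. Let $\{\zeta_i\}_{i\ge1}$ be the points of a Poisson process on $(0,\infty)$ with intensity $\zeta^{-2}\,d\zeta$ and, independently of it, let $Y_1,Y_2,\dots$ be independent copies of a nonnegative stochastic process $Y$ on $\mathcal X$ with continuous sample paths, $\mathbb E\,Y(s)=1$ for all $s\in\mathcal X$, and $\mathbb E\sup_{s\in\mathcal X}Y(s)<\infty$. Let $\eta(s)=\max_{i\ge1}\zeta_iY_i(s)$, $s\in\mathcal X$, be the max-stable process with this spectral representation, let $\tilde\eta$ be an independent copy of $\eta$, and for $s_1,\dots,s_k\in\mathcal X$, $k\ge2$, let $$p(s_1,\dots,s_k)=\mathbb P\bigl\{\text{for some }\ell\ge1:\ \eta(s_j)=\zeta_\ell Y_\ell(s_j),\ j=1,\dots,k\bigr\}$$ be the extremal concurrence probability. Then, for all $k\ge2$ and $s_1,\dots,s_k\in\mathcal X$ (not necessarily distinct), $$p(s_1,\dots,s_k)=\sum_{r=1}^k(-1)^r\sum_{\substack{J\subseteq\{1,\dots,k\}\\|J|=r}}\mathbb E_{\tilde\eta}\Bigl[\log\mathbb P_\eta\bigl\{\eta(s_j)\le\tilde\eta(s_j),\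 j\in J\bigr\}\Bigr],$$ where, for every $J$, the inner probability is almost surely positive and its logarithm is integrable. In particular, for $k=2$, $$p(s_1,s_2)=2+\mathbb E_{\tilde\eta}\Bigl[\log\mathbb P_\eta\bigl\{\eta(s_j)\le\tilde\eta(s_j),\ j=1,2\bigr\}\Bigr].$$ Consequently $p(s_1,\dots,s_k)$ depends only on the law of $\eta$ and not on the chosen spectral representation: if two spectral representations as above yield processes $\eta$ and $\eta'$ with the same law, then their extremal concurrence probabilities coincide, for all $k\ge2$ and $s_1,\dots,s_k\in\mathcal X$. -/

import Mathlib

open MeasureTheory ProbabilityTheory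

/-- The number (possibly infinite) of indices `i` with `x i ω ∈ A`: the random measure that counts
the points `x 0 ω, x 1 ω, …` with multiplicity, evaluated at `A`. -/
noncomputable def pointCount {Ω E : Type*} (x : ℕ → Ω → E) (A : Set E) (ω : Ω) : ℕ∞ :=
  Set.encard {i : ℕ | x i ω ∈ A}

/-- The random points `x 0, x 1, …` are the points of a Poisson process with intensity measure
`Λ` under the probability `P`. -/
structure IsPoissonProcess {Ω E : Type*} [MeasurableSpace Ω] [MeasurableSpace E]
    (P : Measure Ω) (Λ : Measure E) (x : ℕ → Ω → E) : Prop where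
  /-- The points are random variables. -/
  measurable : ∀ i, Measurable (x i)
  /-- The number of points in a set of finite intensity is Poisson distributed. -/
  poisson : ∀ A : Set E, MeasurableSet A → Λ A ≠ ⊤ → ∀ n : ℕ,
    P {ω | pointCount x A ω = n} =
      ENNReal.ofReal (Real.exp (-(Λ A).toReal) * (Λ A).toReal ^ n / (n.factorial : ℝ))
  /-- The numbers of points in pairwise disjoint sets are independent. -/
  indep : ∀ (m : ℕ) (A : Fin m → Set E), (∀ i, MeasurableSet (A i)) →
    Pairwise (fun i j => Disjoint (A i) (A j)) →
    iIndepFun (fun (i : Fin m) (ω : Ω) => pointCount x (A i) ω) P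

/-- The measure `ζ⁻² dζ` on `(0, ∞)`, as a measure on `ℝ` carried by `(0, ∞)`. -/
noncomputable def frechetIntensity : Measure ℝ :=
  (volume.restrict (Set.Ioi (0 : ℝ))).withDensity (fun z => ENNReal.ofReal ((z ^ 2)⁻¹))

/-- The data of a spectral representation of a simple max-stable process on the index space `T`:
a Poisson process `ζ` on `(0, ∞)` with intensity `ζ⁻² dζ` and, independently of it, independent
copies `Y 0, Y 1, …` of a nonnegative process with continuous sample paths, unit mean and
integrable supremum. Laws of processes are laws on `T → ℝ` with the product `σ`-algebra. -/
structure IsSpectralRepresentation {Ω T : Type*} [MeasurableSpace Ω] [TopologicalSpace T]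
    (P : Measure Ω) (ζ : ℕ → Ω → ℝ) (Y : ℕ → Ω → T → ℝ) : Prop where
  pos : ∀ i ω, 0 < ζ i ω
  poisson : IsPoissonProcess P frechetIntensity ζ
  measurable : ∀ i, Measurable (Y i)
  nonneg : ∀ i ω t, 0 ≤ Y i ω t
  continuous : ∀ i ω, Continuous (Y i ω)
  indep_copies : iIndepFun Y P
  ident_copies : ∀ i, IdentDistrib (Y i) (Y 0) P P
  indep : IndepFun (fun ω i => ζ i ω) (fun ω i => Y i ω) P
  mean : ∀ i t, Integrable (fun ω => Y i ω t) P ∧ ∫ ω, Y i ω t ∂P = 1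
  sup : ∀ i, ∫⁻ ω, (⨆ t, ENNReal.ofReal (Y i ω t)) ∂P < ⊤

/-- The max-stable process `η(t) = max_i ζ_i Y_i(t)`. Under a spectral representation the supremum
is, almost surely, finite and attained. -/
noncomputable def maxProcess {Ω T : Type*} (ζ : ℕ → Ω → ℝ) (Y : ℕ → Ω → T → ℝ)
    (ω : Ω) (t : T) : ℝ :=
  ⨆ i, ζ i ω * Y i ω t

/-- The extremal concurrence probability `p(s_1, …, s_k)`: the probability that one and the same
function `ζ_ℓ Y_ℓ` attains the maximum `η` at all the sites. -/
noncomputable def concurrenceProb {Ω T : Type*} [MeasurableSpace Ω] (P : Measure Ω)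
    (ζ : ℕ → Ω → ℝ) (Y : ℕ → Ω → T → ℝ) {k : ℕ} (s : Fin k → T) : ℝ :=
  P.real {ω | ∃ l : ℕ, ∀ j : Fin k, maxProcess ζ Y ω (s j) = ζ l ω * Y l ω (s j)}

/-- For a process `η` under `P` and a fixed path `y`, the probability
`P_η {η(s_j) ≤ y(s_j), j ∈ J}`. -/
noncomputable def belowProb {Ω T : Type*} [MeasurableSpace Ω] (P : Measure Ω)
    (η : Ω → T → ℝ) {k : ℕ} (s : Fin k → T) (J : Finset (Fin k)) (y : T → ℝ) : ℝ :=
  P.real {ω | ∀ j ∈ J, η ω (s j) ≤ y (s j)}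

open Filter Topology
open scoped ENNReal NNReal

/-! Restricted to the sites, the points `x i = ζ i • (Y i (s 1), …, Y i (s k))` form a Poisson
process on `ℝ^k` with some intensity `μ`, and `η` is their coordinatewise supremum. Only two
features of this process are needed, collected in `HasPoissonVoids`: its mean measure is `μ`, and a
set `B` of finite measure is void with probability `exp (-μ B)`. Unit mean of `Y` gives `μ {v | u <
v j} = 1 / u`.

Since `η ≤ y` on `J` means that `exceedSet J y` is void, the logarithm of the inner probability at
`y = η̃` is `-μ (exceedSet J η̃)`. Concurrence means that some point dominates `η`. A point at `v`
does so with probability `P (η ≤ v)`; integrating against `μ` and applying Fubini gives `E μ {v | η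
≤ v}` (`measure_exists_iSup_le`). This instance of Mecke's formula is obtained from void
probabilities alone by counting the cells of a fine grid.

Inclusion–exclusion (`HasFrechetTails.measureReal_le_eq`) writes `μ {v | η ≤ v}` through the masses
`μ (exceedSet J η)`, that is, through the logarithms. The resulting formula involves only the law of
`η`. -/

theorem tsum_ofReal_poisson {l : ℝ} (hl : 0 ≤ l) :
    ∑' n : ℕ, ENNReal.ofReal (Real.exp (-l) * l ^ n / (n.factorial : ℝ)) = 1 := by
  lift l to ℝ≥0 using hl
  have h := hasSum_one_poissonMeasure l
  rw [← ENNReal.ofReal_tsum_of_nonneg (fun n => by positivity) h.summable, h.tsum_eq,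
    ENNReal.ofReal_one]

/-! ### Counts of a Poisson process: generating function and mean measure. -/

section PoissonCounts

variable {Ω E : Type*} [MeasurableSpace Ω] [MeasurableSpace E] {P : Measure Ω} {Λ : Measure E}
  {x : ℕ → Ω → E}

omit [MeasurableSpace Ω] [MeasurableSpace E] in
theorem toENNReal_pointCount (x : ℕ → Ω → E) (A : Set E) (ω : Ω) :
    ((pointCount x A ω : ℕ∞) : ℝ≥0∞) = ∑' i, (x i ⁻¹' A).indicator 1 ω := by
  rw [pointCount, ← ENNReal.tsum_set_one, tsum_subtype {i | x i ω ∈ A} (fun _ => (1 : ℝ≥0∞))]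
  rfl

theorem measurable_pointCount (hx : ∀ i, Measurable (x i)) {A : Set E} (hA : MeasurableSet A) :
    Measurable (pointCount x A) := by
  have h : Measurable fun ω => ((pointCount x A ω : ℕ∞) : ℝ≥0∞) := by
    simp_rw [toENNReal_pointCount]
    exact Measurable.tsum fun i => measurable_one.indicator (hx i hA)
  refine measurable_to_countable' fun n => ?_
  have : pointCount x A ⁻¹' {n} = (fun ω => ((pointCount x A ω : ℕ∞) : ℝ≥0∞)) ⁻¹' {(n : ℝ≥0∞)} := by
    ext ω
    simp
  rw [this]
  exact h (measurableSet_singleton _)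

namespace IsPoissonProcess

theorem ae_pointCount_ne_top [IsProbabilityMeasure P] (h : IsPoissonProcess P Λ x) {A : Set E}
    (hA : MeasurableSet A) (hΛ : Λ A ≠ ∞) : ∀ᵐ ω ∂P, pointCount x A ω ≠ ⊤ := by
  have hm := measurable_pointCount h.measurable hA
  have hsum : P (⋃ n : ℕ, {ω | pointCount x A ω = n}) = 1 := by
    rw [measure_iUnion]
    · simp_rw [h.poisson A hA hΛ]
      exact tsum_ofReal_poisson ENNReal.toReal_nonneg
    · intro m n hmn
      refine Set.disjoint_left.2 fun ω h1 h2 => hmn ?_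
      simp only [Set.mem_ofPred_eq] at h1 h2
      exact_mod_cast h1.symm.trans h2
    · exact fun n => hm (measurableSet_singleton _)
  have := (prob_compl_eq_zero_iff
    (MeasurableSet.iUnion fun n : ℕ => hm (measurableSet_singleton (n : ℕ∞)))).2 hsum
  rw [ae_iff]
  refine measure_mono_null (fun ω hω => ?_) this
  simp only [ne_eq, not_not, Set.mem_ofPred_eq] at hω
  simp [hω]

/-- `toNat` sends an infinite count to `0`; the Poisson weights already sum to one, so this happens
only on a null set. -/
theorem map_toNat_pointCount [IsProbabilityMeasure P] (h : IsPoissonProcess P Λ x) {A : Set E}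
    (hA : MeasurableSet A) (hΛ : Λ A ≠ ∞) :
    P.map (fun ω => (pointCount x A ω).toNat) = poissonMeasure (Λ A).toNNReal := by
  have hm := measurable_pointCount h.measurable hA
  have hm' : Measurable (fun ω => (pointCount x A ω).toNat) :=
    (Measurable.of_discrete (f := ENat.toNat)).comp hm
  refine Measure.ext_of_singleton fun n => ?_
  rw [Measure.map_apply hm' (measurableSet_singleton n), poissonMeasure_singleton]
  refine Eq.trans (measure_congr ?_) (h.poisson A hA hΛ n)
  filter_upwards [h.ae_pointCount_ne_top hA hΛ] with ω hω
  refine propext ?_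
  change (pointCount x A ω).toNat = n ↔ pointCount x A ω = n
  generalize pointCount x A ω = N at hω
  lift N to ℕ using hω
  simp

theorem lintegral_toNat_pointCount [IsProbabilityMeasure P] (h : IsPoissonProcess P Λ x)
    {A : Set E} (hA : MeasurableSet A) (hΛ : Λ A ≠ ∞) (f : ℕ → ℝ≥0∞) :
    ∫⁻ ω, f (pointCount x A ω).toNat ∂P = ∑' n : ℕ, f n *
      ENNReal.ofReal (Real.exp (-(Λ A).toReal) * (Λ A).toReal ^ n / (n.factorial : ℝ)) := by
  have hm := measurable_pointCount h.measurable hA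
  have hm' : Measurable (fun ω => (pointCount x A ω).toNat) :=
    (Measurable.of_discrete (f := ENat.toNat)).comp hm
  rw [← lintegral_map (f := f) Measurable.of_discrete hm', h.map_toNat_pointCount hA hΛ,
    lintegral_countable']
  simp_rw [poissonMeasure_singleton]
  rfl

theorem lintegral_pointCount [IsProbabilityMeasure P] (h : IsPoissonProcess P Λ x)
    {A : Set E} (hA : MeasurableSet A) (hΛ : Λ A ≠ ∞) :
    ∫⁻ ω, ((pointCount x A ω : ℕ∞) : ℝ≥0∞) ∂P = Λ A := by
  have h1 : ∫⁻ ω, ((pointCount x A ω : ℕ∞) : ℝ≥0∞) ∂P =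
      ∫⁻ ω, (((pointCount x A ω).toNat : ℕ) : ℝ≥0∞) ∂P := by
    refine lintegral_congr_ae ?_
    filter_upwards [h.ae_pointCount_ne_top hA hΛ] with ω hω
    generalize pointCount x A ω = N at hω
    lift N to ℕ using hω
    simp
  rw [h1, h.lintegral_toNat_pointCount hA hΛ (fun n => (n : ℝ≥0∞)),
    tsum_eq_zero_add' ENNReal.summable]
  have h3 : ∀ n : ℕ, ((n + 1 : ℕ) : ℝ≥0∞) * ENNReal.ofReal (Real.exp (-(Λ A).toReal) *
      (Λ A).toReal ^ (n + 1) / ((n + 1).factorial : ℝ)) = Λ A *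
        ENNReal.ofReal (Real.exp (-(Λ A).toReal) * (Λ A).toReal ^ n / (n.factorial : ℝ)) := by
    intro n
    conv_rhs => rw [← ENNReal.ofReal_toReal hΛ, ← ENNReal.ofReal_mul ENNReal.toReal_nonneg]
    rw [← ENNReal.ofReal_natCast, ← ENNReal.ofReal_mul (by positivity)]
    rw [Nat.factorial_succ]
    push_cast
    congr 1
    have : (n.factorial : ℝ) ≠ 0 := by positivity
    rw [ENNReal.toReal_ofReal ENNReal.toReal_nonneg]
    field_simp
    ring
  simp_rw [h3]
  rw [ENNReal.tsum_mul_left, tsum_ofReal_poisson ENNReal.toReal_nonneg]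
  simp

theorem lintegral_pow_pointCount [IsProbabilityMeasure P] (h : IsPoissonProcess P Λ x)
    {A : Set E} (hA : MeasurableSet A) (hΛ : Λ A ≠ ∞) {q : ℝ≥0∞} (hq : q ≤ 1) :
    ∫⁻ ω, (1 - q) ^ (pointCount x A ω).toNat ∂P =
      ENNReal.ofReal (Real.exp (-(q * Λ A).toReal)) := by
  have hq' : 1 - q ≠ ∞ := by finiteness
  rw [h.lintegral_toNat_pointCount hA hΛ (fun n => (1 - q) ^ n)]
  have h2 := NormedSpace.expSeries_div_hasSum_exp ((1 - q).toReal * (Λ A).toReal)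
  have h3 : ∀ n : ℕ, (1 - q) ^ n * ENNReal.ofReal (Real.exp (-(Λ A).toReal) *
      (Λ A).toReal ^ n / (n.factorial : ℝ)) = ENNReal.ofReal (Real.exp (-(Λ A).toReal) *
        (((1 - q).toReal * (Λ A).toReal) ^ n / (n.factorial : ℝ))) := by
    intro n
    conv_lhs => rw [← ENNReal.ofReal_toReal hq', ← ENNReal.ofReal_pow ENNReal.toReal_nonneg,
      ← ENNReal.ofReal_mul (by positivity)]
    congr 1
    ring
  simp_rw [h3]
  rw [← ENNReal.ofReal_tsum_of_nonneg (fun n => by positivity) (h2.summable.mul_left _),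
    tsum_mul_left, h2.tsum_eq, ← Real.exp_eq_exp_ℝ, ← Real.exp_add,
    ENNReal.toReal_sub_of_le hq ENNReal.one_ne_top, ENNReal.toReal_mul, ENNReal.toReal_one]
  congr 2
  ring

/-- Campbell's formula: the mean measure of a Poisson process is its intensity. -/
theorem sum_map_eq [IsProbabilityMeasure P] [SigmaFinite Λ] (h : IsPoissonProcess P Λ x) :
    Measure.sum (fun i => P.map (x i)) = Λ := by
  have key : ∀ A, MeasurableSet A → Λ A ≠ ∞ → Measure.sum (fun i => P.map (x i)) A = Λ A := by
    intro A hA hΛ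
    rw [← h.lintegral_pointCount hA hΛ, Measure.sum_apply _ hA]
    simp_rw [toENNReal_pointCount]
    rw [lintegral_tsum fun i => (measurable_one.indicator (h.measurable i hA)).aemeasurable]
    refine tsum_congr fun i => ?_
    rw [Measure.map_apply (h.measurable i) hA, lintegral_indicator_one (h.measurable i hA)]
  -- The counts only control sets of finite intensity, so the two measures are compared on spanning
  -- sets.
  refine Measure.ext_of_iUnion_eq_univ (iUnion_spanningSets Λ) fun n => ?_
  ext A hA
  have hm := hA.inter (measurableSet_spanningSets Λ n)
  rw [Measure.restrict_apply hA, Measure.restrict_apply hA]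
  exact key _ hm ((measure_mono Set.inter_subset_right).trans_lt
    (measure_spanningSets_lt_top Λ n)).ne

end IsPoissonProcess

end PoissonCounts

/-! ### Generating functional of a Poisson process; infinite products of factors at most one are
infima of partial products. -/

theorem iInf_prod_range_eq {u : ℕ → ℝ≥0∞} (hu : ∀ n, u n ≤ 1) (T : Finset ℕ)
    (hT : ∀ n ∉ T, u n = 1) : ⨅ n, ∏ i ∈ Finset.range n, u i = ∏ i ∈ T, u i := by
  refine le_antisymm ?_ (le_iInf fun n => ?_)
  · obtain ⟨n, hn⟩ := T.exists_nat_subset_range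
    exact (iInf_le _ n).trans (Finset.prod_subset hn fun i _ hi => hT i hi).ge
  · calc ∏ i ∈ T, u i = ∏ i ∈ T ∪ Finset.range n, u i :=
          Finset.prod_subset Finset.subset_union_left fun i _ hi => hT i hi
      _ ≤ _ := Finset.prod_le_prod_of_subset_of_le_one' Finset.subset_union_right
          fun i _ _ => hu i

theorem antitone_prod_range {u : ℕ → ℝ≥0∞} (hu : ∀ n, u n ≤ 1) :
    Antitone fun n => ∏ i ∈ Finset.range n, u i := fun _ _ h =>
  Finset.prod_le_prod_of_subset_of_le_one' (Finset.range_mono h) fun i _ _ => hu i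

section Laplace

variable {Ω E : Type*} [MeasurableSpace Ω] [MeasurableSpace E] {P : Measure Ω} {Λ : Measure E}
  {x : ℕ → Ω → E}

omit [MeasurableSpace Ω] in
-- Factors are grouped by the value of `φ`. The value `0` contributes factors `1` and must be left
-- out, because infinitely many points may take it.
theorem iInf_prod_simpleFunc (φ : SimpleFunc E ℝ≥0∞) (ω : Ω)
    (hfin : ∀ c ∈ φ.range.filter (· ≠ 0), pointCount x (φ ⁻¹' {c}) ω ≠ ⊤) :
    ⨅ n, ∏ i ∈ Finset.range n, (1 - φ (x i ω)) =
      ∏ c ∈ φ.range.filter (· ≠ 0), (1 - c) ^ (pointCount x (φ ⁻¹' {c}) ω).toNat := by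
  have hfin' : ∀ c ∈ φ.range.filter (· ≠ 0), {i | φ (x i ω) = c}.Finite := fun c hc =>
    Set.encard_ne_top_iff.1 (hfin c hc)
  have hT : {i | φ (x i ω) ≠ 0}.Finite := by
    refine ((φ.range.filter (· ≠ 0)).finite_toSet.biUnion hfin').subset fun i hi => ?_
    simp only [Set.mem_iUnion]
    exact ⟨φ (x i ω), by simpa using hi, rfl⟩
  rw [iInf_prod_range_eq (fun n => tsub_le_self) hT.toFinset (fun n hn => by
    have : φ (x n ω) = 0 := by simpa using hn
    simp [this])]
  rw [← Finset.prod_fiberwise_of_maps_to (t := φ.range.filter (· ≠ 0)) (g := fun i => φ (x i ω))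
    (fun i hi => by simpa using hi)]
  refine Finset.prod_congr rfl fun c hc => ?_
  have hc0 : c ≠ 0 := (Finset.mem_filter.1 hc).2
  rw [Finset.prod_congr rfl (g := fun _ => 1 - c) (fun i hi => by
    rw [(Finset.mem_filter.1 hi).2]), Finset.prod_const]
  congr 1
  have : {i | x i ω ∈ φ ⁻¹' {c}} =
      ((hT.toFinset.filter fun i => φ (x i ω) = c : Finset ℕ) : Set ℕ) := by
    ext i
    simp only [Set.mem_preimage, Set.mem_singleton_iff, Set.mem_ofPred_eq, Finset.coe_filter,
      Set.Finite.mem_toFinset]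
    exact ⟨fun h => ⟨h ▸ hc0, h⟩, fun h => h.2⟩
  rw [pointCount, this, Set.encard_coe_eq_coe_finsetCard, ENat.toNat_natCast]

namespace IsPoissonProcess

theorem lintegral_iInf_prod_simpleFunc [IsProbabilityMeasure P] (h : IsPoissonProcess P Λ x)
    (φ : SimpleFunc E ℝ≥0∞) (hφ : ∀ e, φ e ≤ 1) (hΛ : φ.lintegral Λ ≠ ∞) :
    ∫⁻ ω, ⨅ n, ∏ i ∈ Finset.range n, (1 - φ (x i ω)) ∂P =
      ENNReal.ofReal (Real.exp (-(φ.lintegral Λ).toReal)) := by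
  set I := φ.range.filter (· ≠ 0) with hI
  have hΛ' : ∀ c ∈ I, Λ (φ ⁻¹' {c}) ≠ ∞ := fun c hc =>
    ((SimpleFunc.finMeasSupp_iff.1 (SimpleFunc.FinMeasSupp.of_lintegral_ne_top hΛ)) c
      (Finset.mem_filter.1 hc).2).ne
  have hle : ∀ c ∈ I, c ≤ 1 := fun c hc => by
    obtain ⟨e, rfl⟩ := SimpleFunc.mem_range.1 (Finset.mem_filter.1 hc).1
    exact hφ e
  have h1 : ∫⁻ ω, ⨅ n, ∏ i ∈ Finset.range n, (1 - φ (x i ω)) ∂P =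
      ∫⁻ ω, ∏ c ∈ I, (1 - c) ^ (pointCount x (φ ⁻¹' {c}) ω).toNat ∂P := by
    refine lintegral_congr_ae ?_
    have : ∀ᵐ ω ∂P, ∀ c ∈ I, pointCount x (φ ⁻¹' {c}) ω ≠ ⊤ :=
      (ae_ball_iff I.countable_toSet).2 fun c hc =>
        h.ae_pointCount_ne_top (φ.measurableSet_fiber c) (hΛ' c hc)
    filter_upwards [this] with ω hω
    exact iInf_prod_simpleFunc φ ω hω
  -- Level sets for distinct values are disjoint, so their counts are independent and the
  -- expectation of the product factors.
  have hind := h.indep I.card (fun i => φ ⁻¹' {(I.equivFin.symm i : ℝ≥0∞)})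
    (fun i => φ.measurableSet_fiber _) (fun i j hij => by
      refine Disjoint.preimage _ (Set.disjoint_singleton.2 fun hc => hij ?_)
      exact I.equivFin.symm.injective (Subtype.ext hc))
  have hind' := hind.comp (fun i (n : ℕ∞) => (1 - (I.equivFin.symm i : ℝ≥0∞)) ^ n.toNat)
    (fun i => Measurable.of_discrete)
  have h2 : ∀ f : ℝ≥0∞ → ℝ≥0∞, ∏ c ∈ I, f c = ∏ i : Fin I.card, f (I.equivFin.symm i) := by
    intro f
    rw [← Finset.prod_coe_sort, Equiv.prod_comp I.equivFin.symm (fun c : I => f c)]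
  rw [h1]
  simp_rw [h2]
  refine (lintegral_prod_eq_prod_lintegral_of_indepFun Finset.univ _ hind' fun i =>
    Measurable.of_discrete.comp
      (measurable_pointCount h.measurable (φ.measurableSet_fiber _))).trans ?_
  have h3 : φ.lintegral Λ = ∑ i : Fin I.card,
      (I.equivFin.symm i : ℝ≥0∞) * Λ (φ ⁻¹' {(I.equivFin.symm i : ℝ≥0∞)}) := by
    rw [Equiv.sum_comp I.equivFin.symm (fun c : I => (c : ℝ≥0∞) * Λ (φ ⁻¹' {(c : ℝ≥0∞)})),
      Finset.sum_coe_sort I (fun c => c * Λ (φ ⁻¹' {c})), SimpleFunc.lintegral, hI,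
      Finset.sum_filter_of_ne]
    intro c _ hc h0
    simp [h0] at hc
  rw [h3, ENNReal.toReal_sum, ← Finset.sum_neg_distrib, Real.exp_sum,
    ENNReal.ofReal_prod_of_nonneg fun _ _ => (Real.exp_pos _).le]
  · refine Finset.prod_congr rfl fun i _ => ?_
    exact h.lintegral_pow_pointCount (φ.measurableSet_fiber _)
      (hΛ' _ (I.equivFin.symm i).2) (hle _ (I.equivFin.symm i).2)
  · intro i _
    exact ENNReal.mul_ne_top ((hle _ (I.equivFin.symm i).2).trans_lt ENNReal.one_lt_top).ne
      (hΛ' _ (I.equivFin.symm i).2)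

/-- The generating functional of a Poisson process. -/
theorem lintegral_iInf_prod [IsProbabilityMeasure P] (h : IsPoissonProcess P Λ x)
    {a : E → ℝ≥0∞} (ham : Measurable a) (ha : ∀ e, a e ≤ 1) (hΛ : ∫⁻ e, a e ∂Λ ≠ ∞) :
    ∫⁻ ω, ⨅ n, ∏ i ∈ Finset.range n, (1 - a (x i ω)) ∂P =
      ENNReal.ofReal (Real.exp (-(∫⁻ e, a e ∂Λ).toReal)) := by
  set φ := SimpleFunc.eapprox a
  have hmono : ∀ e, Monotone fun m => φ m e := fun e m n hmn =>
    SimpleFunc.monotone_eapprox a hmn e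
  have hsup : ∀ e, ⨆ m, φ m e = a e := SimpleFunc.iSup_eapprox_apply ham
  have hle : ∀ m e, φ m e ≤ a e := fun m e => (hsup e).symm ▸ le_iSup (fun m => φ m e) m
  have hlint : Tendsto (fun m => (φ m).lintegral Λ) atTop (𝓝 (∫⁻ e, a e ∂Λ)) := by
    simp_rw [← SimpleFunc.lintegral_eq_lintegral]
    exact lintegral_tendsto_of_tendsto_of_monotone (fun m => (φ m).measurable.aemeasurable)
      (ae_of_all _ hmono) (ae_of_all _ fun e => by
        rw [← hsup e]; exact tendsto_atTop_iSup (hmono e))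
  have hfin : ∀ m, (φ m).lintegral Λ ≠ ∞ := fun m => by
    rw [← SimpleFunc.lintegral_eq_lintegral]
    exact ((lintegral_mono (hle m)).trans_lt hΛ.lt_top).ne
  have hmeas : ∀ b : E → ℝ≥0∞, Measurable b →
      Measurable fun ω => ⨅ n, ∏ i ∈ Finset.range n, (1 - b (x i ω)) := fun b hb =>
    Measurable.iInf fun n => Finset.measurable_prod _ fun i _ =>
      measurable_const.sub (hb.comp (h.measurable i))
  have hlhs : Tendsto (fun m => ∫⁻ ω, ⨅ n, ∏ i ∈ Finset.range n, (1 - φ m (x i ω)) ∂P) atTop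
      (𝓝 (∫⁻ ω, ⨅ n, ∏ i ∈ Finset.range n, (1 - a (x i ω)) ∂P)) := by
    refine tendsto_lintegral_of_dominated_convergence (fun _ => 1) (fun m => hmeas _ (φ m).measurable)
      (fun m => ae_of_all _ fun ω => (iInf_le _ 0).trans (by simp)) (by simp)
      (ae_of_all _ fun ω => ?_)
    have h1 : ∀ m, Antitone fun n => ∏ i ∈ Finset.range n, (1 - φ m (x i ω)) := fun m =>
      antitone_prod_range fun _ => tsub_le_self
    have h2 : ∀ n, Tendsto (fun m => ∏ i ∈ Finset.range n, (1 - φ m (x i ω))) atTop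
        (𝓝 (∏ i ∈ Finset.range n, (1 - a (x i ω)))) := fun n => by
      refine ENNReal.tendsto_finsetProd_of_ne_top _ (fun i _ => ?_) fun i _ => by finiteness
      refine ENNReal.Tendsto.sub tendsto_const_nhds ?_ (Or.inl ENNReal.one_ne_top)
      rw [← hsup]; exact tendsto_atTop_iSup (hmono _)
    have h3 : ∀ n, Antitone fun m => ∏ i ∈ Finset.range n, (1 - φ m (x i ω)) := fun n m m' hm =>
      Finset.prod_le_prod' fun i _ => tsub_le_tsub_left (hmono _ hm) _
    have h4 : ∀ n, ∏ i ∈ Finset.range n, (1 - a (x i ω)) =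
        ⨅ m, ∏ i ∈ Finset.range n, (1 - φ m (x i ω)) := fun n =>
      tendsto_nhds_unique (h2 n) (tendsto_atTop_iInf (h3 n))
    simp_rw [h4]
    -- The partial products decrease both in the number of factors and in the approximation index,
    -- so both limits are infima and may be exchanged.
    rw [iInf_comm]
    exact tendsto_atTop_iInf fun m m' hm => iInf_mono fun n => h3 n hm
  refine tendsto_nhds_unique hlhs ?_
  simp_rw [fun m => h.lintegral_iInf_prod_simpleFunc (φ m) (fun e => (hle m e).trans (ha e)) (hfin m)]
  exact ENNReal.tendsto_ofReal ((Real.continuous_exp.tendsto _).comp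
    ((ENNReal.tendsto_toReal hΛ).comp hlint).neg)

end IsPoissonProcess

end Laplace

/-- The random points `x 0, x 1, …` have mean measure `μ`, and avoid every set `B` of finite
measure with probability `exp (-μ B)`. -/
structure HasPoissonVoids {Ω E : Type*} [MeasurableSpace Ω] [MeasurableSpace E]
    (P : Measure Ω) (μ : Measure E) (x : ℕ → Ω → E) : Prop where
  measurable : ∀ i, Measurable (x i)
  mean : ∀ A, MeasurableSet A → ∑' i, P (x i ⁻¹' A) = μ A
  void : ∀ B, MeasurableSet B → μ B ≠ ∞ →
    P {ω | ∀ i, x i ω ∉ B} = ENNReal.ofReal (Real.exp (-(μ B).toReal))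

namespace HasPoissonVoids

variable {Ω E F : Type*} [MeasurableSpace Ω] [MeasurableSpace E] [MeasurableSpace F]
  {P : Measure Ω} {μ : Measure E} {x : ℕ → Ω → E}

theorem map (h : HasPoissonVoids P μ x) {f : E → F} (hf : Measurable f) :
    HasPoissonVoids P (μ.map f) (fun i ω => f (x i ω)) where
  measurable i := hf.comp (h.measurable i)
  mean A hA := by
    rw [Measure.map_apply hf hA, ← h.mean _ (hf hA)]
    rfl
  void B hB hμ := by
    rw [Measure.map_apply hf hB] at hμ ⊢
    exact h.void _ (hf hB) hμ

end HasPoissonVoids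

/-! ### Independent marking. -/

section Marking

variable {Ω F M : Type*} [MeasurableSpace Ω] [MeasurableSpace F] [MeasurableSpace M]
  {P : Measure Ω} [IsProbabilityMeasure P] {Λ : Measure F} {z : ℕ → Ω → F} {V : ℕ → Ω → M}

theorem measure_forall_mk_notMem (hV : ∀ i, Measurable (V i)) (hind : iIndepFun V P)
    (hid : ∀ i, IdentDistrib (V i) (V 0) P P) (B : Set (F × M)) (hB : MeasurableSet B)
    (y : ℕ → F) :
    P {ω | ∀ i, (y i, V i ω) ∉ B} =
      ⨅ n, ∏ i ∈ Finset.range n, (1 - P.map (V 0) (Prod.mk (y i) ⁻¹' B)) := by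
  have := Measure.isProbabilityMeasure_map (μ := P) (hV 0).aemeasurable
  have hBi : ∀ i, MeasurableSet (Prod.mk (y i) ⁻¹' B) := fun i => measurable_prodMk_left hB
  have h1 : {ω | ∀ i, (y i, V i ω) ∉ B} =
      ⋂ n : ℕ, ⋂ i ∈ Finset.range n, V i ⁻¹' (Prod.mk (y i) ⁻¹' B)ᶜ := by
    ext ω
    simp only [Set.mem_ofPred_eq, Set.mem_iInter, Set.mem_preimage, Set.mem_compl_iff,
      Finset.mem_range]
    exact ⟨fun h _ i _ => h i, fun h i => h (i + 1) i i.lt_succ_self⟩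
  rw [h1, Antitone.measure_iInter]
  · refine iInf_congr fun n => ?_
    rw [hind.measure_inter_preimage_eq_mul (Finset.range n) (sets := fun i => (Prod.mk (y i) ⁻¹' B)ᶜ)
      fun i _ => (hBi i).compl]
    refine Finset.prod_congr rfl fun i _ => ?_
    rw [← Measure.map_apply (hV i) (hBi i).compl, (hid i).map_eq, prob_compl_eq_one_sub (hBi i)]
  · intro m n hmn
    exact Set.biInter_subset_biInter_left (Finset.range_mono hmn)
  · exact fun n => ((Finset.range n).measurableSet_biInter fun i _ =>
      hV i (hBi i).compl).nullMeasurableSet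
  · exact ⟨0, measure_ne_top _ _⟩

/-- Independent marks turn a Poisson process into a Poisson process on the product space. -/
theorem IsPoissonProcess.hasPoissonVoids_marked [SigmaFinite Λ] (h : IsPoissonProcess P Λ z)
    (hV : ∀ i, Measurable (V i)) (hind : iIndepFun V P)
    (hid : ∀ i, IdentDistrib (V i) (V 0) P P)
    (hzV : IndepFun (fun ω i => z i ω) (fun ω i => V i ω) P) :
    HasPoissonVoids P (Λ.prod (P.map (V 0))) (fun i ω => (z i ω, V i ω)) where
  measurable i := (h.measurable i).prodMk (hV i)
  mean A hA := by
    have := Measure.isProbabilityMeasure_map (μ := P) (hV 0).aemeasurable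
    rw [← h.sum_map_eq, Measure.prod_sum_left, Measure.sum_apply _ hA]
    refine tsum_congr fun i => ?_
    have hi : IndepFun (z i) (V i) P :=
      hzV.comp (φ := fun y : ℕ → F => y i) (ψ := fun v : ℕ → M => v i) (measurable_pi_apply i)
        (measurable_pi_apply i)
    rw [← Measure.map_apply ((h.measurable i).prodMk (hV i)) hA, ← (hid i).map_eq,
      (indepFun_iff_map_prod_eq_prod_map_map (h.measurable i).aemeasurable
        (hV i).aemeasurable).1 hi]
  void B hB hμ := by
    have := Measure.isProbabilityMeasure_map (μ := P) (hV 0).aemeasurable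
    have hzm : Measurable fun ω i => z i ω := measurable_pi_lambda _ h.measurable
    have hVm : Measurable fun ω i => V i ω := measurable_pi_lambda _ hV
    have := Measure.isProbabilityMeasure_map (μ := P) hVm.aemeasurable
    have hS : MeasurableSet {p : (ℕ → F) × (ℕ → M) | ∀ i, (p.1 i, p.2 i) ∉ B} := by
      simp only [Set.ofPred_forall]
      refine MeasurableSet.iInter fun i => ?_
      have : Measurable fun p : (ℕ → F) × (ℕ → M) => (p.1 i, p.2 i) := by fun_prop
      exact (this hB).compl
    have ham : Measurable fun y => P.map (V 0) (Prod.mk y ⁻¹' B) := measurable_measure_prodMk_left hB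
    rw [Measure.prod_apply hB] at hμ ⊢
    -- Given the positions, the marked points avoid `B` with probability the product of `1 - a (z
    -- i)`, where `a y` is the probability that a mark falls in the section of `B` at `y`. The
    -- generating functional then applies, since the integral of `a` is the product measure of `B`.
    rw [← h.lintegral_iInf_prod ham (fun e => prob_le_one) hμ]
    have h1 : P {ω | ∀ i, (z i ω, V i ω) ∉ B} = (P.map fun ω => ((fun i => z i ω), fun i => V i ω))
        {p : (ℕ → F) × (ℕ → M) | ∀ i, (p.1 i, p.2 i) ∉ B} := by
      rw [Measure.map_apply (hzm.prodMk hVm) hS]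
      rfl
    rw [h1, (indepFun_iff_map_prod_eq_prod_map_map hzm.aemeasurable hVm.aemeasurable).1 hzV,
      Measure.prod_apply hS, lintegral_map (measurable_measure_prodMk_left hS) hzm]
    refine lintegral_congr fun ω => ?_
    rw [Measure.map_apply hVm (measurable_prodMk_left hS),
      ← measure_forall_mk_notMem hV hind hid B hB (fun i => z i ω)]
    rfl

end Marking

/-! ### The intensity `ζ⁻² dζ`. -/

section Frechet

instance sigmaFinite_frechetIntensity : SigmaFinite frechetIntensity :=
  SigmaFinite.withDensity_ofReal _

theorem frechetIntensity_Ioi {c : ℝ} (hc : 0 < c) :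
    frechetIntensity (Set.Ioi c) = ENNReal.ofReal c⁻¹ := by
  have h1 : ∀ t ∈ Set.Ioi c, (t ^ 2)⁻¹ = t ^ (-2 : ℝ) := fun t ht => by
    rw [Real.rpow_neg (hc.trans ht).le]
    norm_num
  rw [frechetIntensity, withDensity_apply _ measurableSet_Ioi, Measure.restrict_restrict
    measurableSet_Ioi, Set.inter_eq_left.2 (Set.Ioi_subset_Ioi hc.le),
    ← ofReal_integral_eq_lintegral_ofReal]
  · rw [setIntegral_congr_fun measurableSet_Ioi h1, integral_Ioi_rpow_of_lt (by norm_num) hc]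
    norm_num
    rw [Real.rpow_neg_one]
  · exact (integrableOn_congr_fun h1 measurableSet_Ioi).2
      (integrableOn_Ioi_rpow_of_lt (by norm_num) hc)
  · exact ae_of_all _ fun t => by positivity

/-- Linearity in `v` is the point: averaging over a spectral function leaves only its mean, which is
one. -/
theorem frechetIntensity_lt_mul {u v : ℝ} (hu : 0 < u) (hv : 0 ≤ v) :
    frechetIntensity {z | u < z * v} = ENNReal.ofReal (u⁻¹ * v) := by
  obtain rfl | hv := hv.eq_or_lt
  · simp [hu.not_gt]
  · have : {z | u < z * v} = Set.Ioi (u / v) := by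
      ext z
      simp [div_lt_iff₀ hv]
    rw [this, frechetIntensity_Ioi (div_pos hu hv), inv_div]
    congr 1
    ring

end Frechet

/-- The vectors that exceed `y` in some coordinate belonging to `J`. -/
def exceedSet {ι : Type*} (J : Finset ι) (y : ι → ℝ) : Set (ι → ℝ) := {v | ∃ j ∈ J, y j < v j}

/-- The measure of each half-space `{v | u < v j}` is that of a unit Fréchet intensity. -/
def HasFrechetTails {ι : Type*} (μ : Measure (ι → ℝ)) : Prop :=
  ∀ j, ∀ u, 0 < u → μ {v | u < v j} = ENNReal.ofReal u⁻¹

/-! ### Measures with unit Fréchet tails. -/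

section ExceedSet

variable {ι : Type*} {μ : Measure (ι → ℝ)}

theorem exceedSet_eq_biUnion (J : Finset ι) (y : ι → ℝ) :
    exceedSet J y = ⋃ j ∈ J, {v | y j < v j} := by
  ext v
  simp [exceedSet]

theorem measurableSet_coord_lt (j : ι) (u : ℝ) : MeasurableSet {v : ι → ℝ | u < v j} :=
  measurableSet_lt measurable_const (measurable_pi_apply j)

theorem measurableSet_exceedSet (J : Finset ι) (y : ι → ℝ) : MeasurableSet (exceedSet J y) := by
  rw [exceedSet_eq_biUnion]
  exact J.measurableSet_biUnion fun j _ => measurableSet_coord_lt j _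

namespace HasFrechetTails

theorem measure_exceedSet_le (hμ : HasFrechetTails μ) {J : Finset ι} {y : ι → ℝ}
    (hy : ∀ j ∈ J, 0 < y j) : μ (exceedSet J y) ≤ ∑ j ∈ J, ENNReal.ofReal (y j)⁻¹ := by
  rw [exceedSet_eq_biUnion]
  refine (measure_biUnion_finset_le J _).trans (Finset.sum_le_sum fun j hj => ?_)
  exact (hμ j _ (hy j hj)).le

theorem measure_exceedSet_ne_top (hμ : HasFrechetTails μ) {J : Finset ι} {y : ι → ℝ}
    (hy : ∀ j ∈ J, 0 < y j) : μ (exceedSet J y) ≠ ∞ :=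
  ((hμ.measure_exceedSet_le hy).trans_lt (ENNReal.sum_lt_top.2 fun _ _ => ENNReal.ofReal_lt_top)).ne

theorem measure_lt_le (hμ : HasFrechetTails μ) (j : ι) {a b : ℝ} (ha : 0 < a) (hab : a ≤ b) :
    μ {v | a < v j ∧ v j ≤ b} = ENNReal.ofReal (a⁻¹ - b⁻¹) := by
  have h1 : {v : ι → ℝ | a < v j ∧ v j ≤ b} = {v | a < v j} \ {v | b < v j} := by
    ext v
    simp
  have h2 : {v : ι → ℝ | b < v j} ⊆ {v | a < v j} := Set.ofPred_subset_ofPred.2 fun v hv =>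
    hab.trans_lt hv
  rw [h1, measure_sdiff h2 (measurableSet_coord_lt j b).nullMeasurableSet
    (by rw [hμ j b (ha.trans_le hab)]; exact ENNReal.ofReal_ne_top), hμ j a ha,
    hμ j b (ha.trans_le hab), ENNReal.ofReal_sub _ (by have := ha.trans_le hab; positivity)]

/-- The hyperplane lies in the slabs `a < v j ≤ c`, whose mass `1 / a - 1 / c` vanishes as `a`
increases to `c`. This allows weak and strict inequalities to be exchanged in the
inclusion–exclusion. -/
theorem measure_coord_eq (hμ : HasFrechetTails μ) (j : ι) {c : ℝ} (hc : 0 < c) :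
    μ {v | v j = c} = 0 := by
  have hlim : Tendsto (fun a : ℝ => ENNReal.ofReal (a⁻¹ - c⁻¹)) (𝓝[<] c) (𝓝 0) := by
    have : Tendsto (fun a : ℝ => a⁻¹ - c⁻¹) (𝓝 c) (𝓝 (c⁻¹ - c⁻¹)) :=
      (tendsto_inv₀ hc.ne').sub_const _
    rw [sub_self] at this
    simpa using ENNReal.tendsto_ofReal (this.mono_left nhdsWithin_le_nhds)
  refine le_antisymm (ge_of_tendsto hlim ?_) zero_le
  filter_upwards [Ioo_mem_nhdsLT hc] with a ha
  rw [← hμ.measure_lt_le j ha.1 ha.2.le]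
  exact measure_mono fun v hv => by
    simp only [Set.mem_ofPred_eq] at hv ⊢
    exact ⟨hv ▸ ha.2, hv.le⟩

end HasFrechetTails

end ExceedSet

/-! ### The coordinatewise supremum: finiteness, distribution function, exponential reciprocals. -/

namespace HasPoissonVoids

section Margins

variable {Ω ι : Type*} [MeasurableSpace Ω] [Finite ι] {P : Measure Ω} [IsProbabilityMeasure P]
  {μ : Measure (ι → ℝ)} {x : ℕ → Ω → ι → ℝ}

/-- The probability that no coordinate of any point exceeds `n + 1` tends to one. Boundedness is
essential because a real `⨆` over an unbounded family has the default value `0`. -/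
theorem ae_bddAbove (h : HasPoissonVoids P μ x) (hμ : HasFrechetTails μ) :
    ∀ᵐ ω ∂P, ∀ j, BddAbove (Set.range fun i => x i ω j) := by
  cases nonempty_fintype ι
  set B : ℕ → Set (ι → ℝ) := fun n => exceedSet Finset.univ fun _ => (n + 1 : ℝ)
  have hpos : ∀ n : ℕ, ∀ j ∈ (Finset.univ : Finset ι), (0 : ℝ) < n + 1 := fun n _ _ => by positivity
  have hfin : ∀ n, μ (B n) ≠ ∞ := fun n => hμ.measure_exceedSet_ne_top (hpos n)
  have hB : Tendsto (fun n => (μ (B n)).toReal) atTop (𝓝 0) := by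
    have h0 : Tendsto (fun n : ℕ => (Fintype.card ι : ℝ) * ((n : ℝ) + 1)⁻¹) atTop (𝓝 0) := by
      simpa using (tendsto_one_div_add_atTop_nhds_zero_nat (𝕜 := ℝ)).const_mul (Fintype.card ι : ℝ)
    refine squeeze_zero (fun _ => ENNReal.toReal_nonneg) (fun n => ?_) h0
    refine ENNReal.toReal_le_of_le_ofReal (by positivity)
      ((hμ.measure_exceedSet_le (hpos n)).trans_eq ?_)
    rw [Finset.sum_const, Finset.card_univ, ENNReal.ofReal_mul (by positivity), nsmul_eq_mul,
      ENNReal.ofReal_natCast]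
  have hlim : Tendsto (fun n => ENNReal.ofReal (Real.exp (-(μ (B n)).toReal))) atTop (𝓝 1) := by
    have := ENNReal.tendsto_ofReal ((Real.continuous_exp.tendsto _).comp hB.neg)
    simpa using this
  refine (prob_compl_eq_zero_iff₀ ?_).2 ?_
  · have : MeasurableSet {ω | ∀ j, BddAbove (Set.range fun i => x i ω j)} := by
      rw [Set.ofPred_forall]
      exact MeasurableSet.iInter fun j => measurableSet_bddAbove_range fun i =>
        (measurable_pi_apply j).comp (h.measurable i)
    exact this.nullMeasurableSet
  · refine le_antisymm prob_le_one (le_of_tendsto' hlim fun n => ?_)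
    rw [← h.void _ (measurableSet_exceedSet _ _) (hfin n)]
    refine measure_mono fun ω hω j => ⟨n + 1, ?_⟩
    rintro _ ⟨i, rfl⟩
    have := hω i
    simp only [exceedSet, Set.mem_ofPred_eq, Finset.mem_univ, true_and, not_exists,
      not_lt] at this
    exact this j

omit [Finite ι] [IsProbabilityMeasure P] in
theorem measurable_iSup (h : HasPoissonVoids P μ x) :
    Measurable fun ω j => ⨆ i, x i ω j :=
  measurable_pi_lambda _ fun j => Measurable.iSup fun i =>
    (measurable_pi_apply j).comp (h.measurable i)

theorem measure_forall_iSup_le (h : HasPoissonVoids P μ x) (hμ : HasFrechetTails μ)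
    {J : Finset ι} {y : ι → ℝ} (hy : ∀ j ∈ J, 0 < y j) :
    P {ω | ∀ j ∈ J, ⨆ i, x i ω j ≤ y j} =
      ENNReal.ofReal (Real.exp (-(μ (exceedSet J y)).toReal)) := by
  rw [← h.void _ (measurableSet_exceedSet _ _) (hμ.measure_exceedSet_ne_top hy)]
  refine measure_congr ?_
  filter_upwards [h.ae_bddAbove hμ] with ω hω
  refine propext ?_
  change (∀ j ∈ J, ⨆ i, x i ω j ≤ y j) ↔ ∀ i, x i ω ∉ exceedSet J y
  simp only [ciSup_le_iff (hω _), exceedSet, Set.mem_ofPred_eq, not_exists, not_and, not_lt]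
  exact ⟨fun h i j hj => h j hj i, fun h j hj i => h i j hj⟩

theorem measure_iSup_le (h : HasPoissonVoids P μ x) (hμ : HasFrechetTails μ) (j : ι) {u : ℝ}
    (hu : 0 < u) : P {ω | ⨆ i, x i ω j ≤ u} = ENNReal.ofReal (Real.exp (-u⁻¹)) := by
  have := h.measure_forall_iSup_le hμ (J := {j}) (y := fun _ => u) fun _ _ => hu
  simp only [Finset.mem_singleton, forall_eq] at this
  have h2 : exceedSet {j} (fun _ => u) = {v | u < v j} := by
    ext v
    simp [exceedSet]
  rw [this, h2, hμ j u hu, ENNReal.toReal_ofReal (by positivity)]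

theorem ae_iSup_pos (h : HasPoissonVoids P μ x) (hμ : HasFrechetTails μ) :
    ∀ᵐ ω ∂P, ∀ j, 0 < ⨆ i, x i ω j := by
  refine ae_all_iff.2 fun j => ?_
  simp_rw [ae_iff, not_lt]
  have hlim : Tendsto (fun u : ℝ => ENNReal.ofReal (Real.exp (-u⁻¹))) (𝓝[>] 0) (𝓝 0) := by
    have := ENNReal.tendsto_ofReal (Real.tendsto_exp_neg_atTop_nhds_zero.comp
      tendsto_inv_nhdsGT_zero)
    simpa using this
  refine le_antisymm (ge_of_tendsto hlim ?_) zero_le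
  filter_upwards [self_mem_nhdsWithin] with u hu
  rw [← h.measure_iSup_le hμ j hu]
  refine measure_mono (Set.ofPred_subset_ofPred.2 fun ω hω => ?_)
  exact le_trans hω (le_of_lt hu)

/-- The reciprocal of a unit Fréchet variable is standard exponential. This yields both the
integrability of the logarithms and the value `-1` for singletons. -/
theorem lintegral_inv_iSup (h : HasPoissonVoids P μ x) (hμ : HasFrechetTails μ) (j : ι) :
    ∫⁻ ω, ENNReal.ofReal (⨆ i, x i ω j)⁻¹ ∂P = 1 := by
  have hpos : ∀ᵐ ω ∂P, 0 < ⨆ i, x i ω j := (h.ae_iSup_pos hμ).mono fun ω hω => hω j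
  have hm : Measurable fun ω => ⨆ i, x i ω j := (measurable_pi_apply j).comp h.measurable_iSup
  rw [lintegral_eq_lintegral_meas_le P (hpos.mono fun ω hω => (inv_pos.2 hω).le)
    hm.inv.aemeasurable]
  have h1 : ∀ t ∈ Set.Ioi (0 : ℝ), P {ω | t ≤ (⨆ i, x i ω j)⁻¹} =
      ENNReal.ofReal (Real.exp (-t)) := by
    intro t ht
    have h2 := h.measure_iSup_le hμ j (inv_pos.2 ht)
    rw [inv_inv] at h2
    rw [← h2]
    refine measure_congr ?_
    filter_upwards [hpos] with ω hω
    exact propext (le_inv_comm₀ ht hω)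
  rw [setLIntegral_congr_fun measurableSet_Ioi h1, ← ofReal_integral_eq_lintegral_ofReal
    (integrableOn_exp_neg_Ioi 0) (ae_of_all _ fun t => (Real.exp_pos _).le),
    integral_exp_neg_Ioi_zero, ENNReal.ofReal_one]

end Margins

end HasPoissonVoids

/-! ### Dyadic grids. -/

section Grid

variable {ι : Type*}

/-- The index of the cell of the dyadic grid of mesh `2⁻ⁿ` containing `v`. -/
noncomputable def gridIndex (n : ℕ) (v : ι → ℝ) : ι → ℤ := fun j => ⌈v j * 2 ^ n⌉

/-- The upper corner of a cell of the dyadic grid of mesh `2⁻ⁿ`. -/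
noncomputable def gridCorner (n : ℕ) (g : ι → ℤ) : ι → ℝ := fun j => g j / 2 ^ n

theorem le_gridCorner (n : ℕ) (v : ι → ℝ) : v ≤ gridCorner n (gridIndex n v) := fun j => by
  rw [gridCorner, le_div_iff₀ (by positivity)]
  exact Int.le_ceil _

theorem gridCorner_lt (n : ℕ) (v : ι → ℝ) (j : ι) :
    gridCorner n (gridIndex n v) j < v j + (2 ^ n)⁻¹ := by
  rw [gridCorner, div_lt_iff₀ (by positivity), add_mul, inv_mul_cancel₀ (by positivity)]
  exact Int.ceil_lt_add_one _

theorem tendsto_inv_two_pow : Tendsto (fun n : ℕ => ((2 : ℝ) ^ n)⁻¹) atTop (𝓝 0) := by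
  simpa using tendsto_pow_atTop_nhds_zero_of_lt_one (r := (2⁻¹ : ℝ)) (by norm_num) (by norm_num)

/-- Upper corners approach `v` from above, so `h ≤ v` is never lost, while a failure in one
coordinate shows once the mesh is below the gap there. -/
theorem eventually_le_gridCorner_iff (h v : ι → ℝ) :
    ∀ᶠ n in atTop, (h ≤ gridCorner n (gridIndex n v) ↔ h ≤ v) := by
  by_cases hv : h ≤ v
  · exact Eventually.of_forall fun n => iff_of_true (hv.trans (le_gridCorner n v)) hv
  · obtain ⟨j, hj⟩ : ∃ j, v j < h j := by simpa [Pi.le_def] using hv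
    filter_upwards [tendsto_inv_two_pow.eventually_lt_const (sub_pos.2 hj)] with n hn
    refine iff_of_false (fun h' => ?_) hv
    have := (h' j).trans_lt (gridCorner_lt n v j)
    linarith

theorem measurable_gridIndex (n : ℕ) : Measurable (gridIndex n : (ι → ℝ) → ι → ℤ) :=
  measurable_pi_lambda _ fun j => Int.measurable_ceil.comp
    ((measurable_pi_apply j).mul_const _)

/-- The vectors all of whose coordinates exceed `ε`. -/
def orthant (ι : Type*) (ε : ℝ) : Set (ι → ℝ) := {v | ∀ j, ε < v j}

theorem measurableSet_orthant [Countable ι] (ε : ℝ) : MeasurableSet (orthant ι ε) := by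
  rw [orthant, Set.ofPred_forall]
  exact MeasurableSet.iInter fun j => measurableSet_coord_lt j ε

/-- The part of a grid cell in the orthant above `ε`. -/
def gridCell (ε : ℝ) (n : ℕ) (g : ι → ℤ) : Set (ι → ℝ) := orthant ι ε ∩ gridIndex n ⁻¹' {g}

theorem measurableSet_gridCell [Countable ι] (ε : ℝ) (n : ℕ) (g : ι → ℤ) :
    MeasurableSet (gridCell ε n g) :=
  (measurableSet_orthant ε).inter (measurable_gridIndex n (measurableSet_singleton g))

theorem HasFrechetTails.measure_orthant_ne_top [Nonempty ι] {μ : Measure (ι → ℝ)}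
    (hμ : HasFrechetTails μ) {ε : ℝ} (hε : 0 < ε) : μ (orthant ι ε) ≠ ∞ := by
  obtain ⟨j⟩ := ‹Nonempty ι›
  refine ((measure_mono (?_ : orthant ι ε ⊆ {v | ε < v j})).trans_lt ?_).ne
  · exact fun v hv => hv j
  · rw [hμ j ε hε]
    exact ENNReal.ofReal_lt_top

/-- A nonempty cell lies in a slab `b - d < v j ≤ b` with `d = 2⁻ⁿ`, `b > ε` and `b - d > ε / 2`, of
mass `d / ((b - d) * b)`. Cells are thus uniformly small, so `1 - exp (-a)` may be replaced by the
cell mass `a`. -/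
theorem HasFrechetTails.measure_gridCell_le [Nonempty ι] {μ : Measure (ι → ℝ)}
    (hμ : HasFrechetTails μ) {ε : ℝ} (hε : 0 < ε) {n : ℕ} (hn : ((2 : ℝ) ^ n)⁻¹ ≤ ε / 2)
    (g : ι → ℤ) : μ (gridCell ε n g) ≤ ENNReal.ofReal (2 / ε ^ 2 * (2 ^ n)⁻¹) := by
  obtain hne | ⟨w, hw⟩ := (gridCell ε n g).eq_empty_or_nonempty
  · simp [hne]
  obtain ⟨j⟩ := ‹Nonempty ι›
  have hg : gridIndex n w = g := hw.2
  set b := gridCorner n g j with hb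
  have hεb : ε < b := (hw.1 j).trans_le (hb ▸ hg ▸ le_gridCorner n w j)
  set d : ℝ := ((2 : ℝ) ^ n)⁻¹ with hd
  have hd0 : 0 < d := by positivity
  have hbd : ε / 2 < b - d := by linarith
  have hbd0 : 0 < b - d := by linarith
  have h1 : gridCell ε n g ⊆ {v | b - d < v j ∧ v j ≤ b} := by
    intro v hv
    have hv2 : gridIndex n v = g := hv.2
    refine ⟨?_, ?_⟩
    · have := gridCorner_lt n v j
      rw [hv2] at this
      linarith
    · have := le_gridCorner n v j
      rwa [hv2] at this
  refine (measure_mono h1).trans ((hμ.measure_lt_le j hbd0 (by linarith)).trans_le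
    (ENNReal.ofReal_le_ofReal ?_))
  have hb0 : 0 < b := by linarith
  have h2 : (b - d)⁻¹ - b⁻¹ = d / ((b - d) * b) := by
    field_simp
    ring
  have h3 : 2 / ε ^ 2 * d = d / (ε / 2 * ε) := by field_simp
  rw [h2, h3]
  exact div_le_div_of_nonneg_left hd0.le (by positivity)
    (mul_le_mul hbd.le hεb.le hε.le hbd0.le)

end Grid

/-! ### Mecke's formula for dominating points, from void probabilities. -/

namespace HasPoissonVoids

variable {Ω ι : Type*} [MeasurableSpace Ω] [Finite ι] [Nonempty ι] {P : Measure Ω}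
  [IsProbabilityMeasure P] {μ : Measure (ι → ℝ)} {x : ℕ → Ω → ι → ℝ}

/-- The event that a grid cell contains one of the points and that no point exceeds the upper
corner of the cell. -/
def cellEvent (x : ℕ → Ω → ι → ℝ) (ε : ℝ) (n : ℕ) (g : ι → ℤ) : Set Ω :=
  {ω | (∃ l, x l ω ∈ gridCell ε n g) ∧ ∀ l, x l ω ≤ gridCorner n g}

omit [Nonempty ι] [IsProbabilityMeasure P] in
theorem measurableSet_cellEvent (h : HasPoissonVoids P μ x) (ε : ℝ) (n : ℕ) (g : ι → ℤ) :
    MeasurableSet (cellEvent x ε n g) := by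
  rw [cellEvent, Set.ofPred_and, Set.ofPred_exists, Set.ofPred_forall]
  exact (MeasurableSet.iUnion fun l => h.measurable l (measurableSet_gridCell ε n g)).inter
    (MeasurableSet.iInter fun l => h.measurable l measurableSet_Iic)

/-- The cell `A` is disjoint from the set `B` of vectors exceeding its corner. The event says that
`B` is void but `A ∪ B` is not, so its probability is `exp (-μ B) - exp (-μ A - μ B)`. -/
theorem measure_cellEvent (h : HasPoissonVoids P μ x) (hμ : HasFrechetTails μ) {ε : ℝ}
    (hε : 0 < ε) (n : ℕ) (g : ι → ℤ) :
    P (cellEvent x ε n g) = P {ω | (fun j => ⨆ i, x i ω j) ≤ gridCorner n g} *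
      ENNReal.ofReal (1 - Real.exp (-(μ (gridCell ε n g)).toReal)) := by
  cases nonempty_fintype ι
  obtain hne | ⟨w, hw⟩ := (gridCell ε n g).eq_empty_or_nonempty
  · simp [hne, cellEvent]
  have hg : gridIndex n w = g := hw.2
  have hpos : ∀ j ∈ (Finset.univ : Finset ι), 0 < gridCorner n g j := fun j _ =>
    hε.trans ((hw.1 j).trans_le (hg ▸ le_gridCorner n w j))
  set A := gridCell ε n g
  set B := exceedSet Finset.univ (gridCorner n g)
  have hA : MeasurableSet A := measurableSet_gridCell ε n g
  have hB : MeasurableSet B := measurableSet_exceedSet _ _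
  have hμA : μ A ≠ ∞ := ((measure_mono Set.inter_subset_left).trans_lt
    (hμ.measure_orthant_ne_top hε).lt_top).ne
  have hμB : μ B ≠ ∞ := hμ.measure_exceedSet_ne_top hpos
  have hB' : ∀ v, v ∉ B ↔ v ≤ gridCorner n g := fun v => by
    simp [B, exceedSet, Pi.le_def]
  have hdisj : Disjoint A B := Set.disjoint_left.2 fun v hvA => by
    have hv : gridIndex n v = g := hvA.2
    rw [hB', ← hv]
    exact le_gridCorner n v
  have hη : P {ω | (fun j => ⨆ i, x i ω j) ≤ gridCorner n g} =
      ENNReal.ofReal (Real.exp (-(μ B).toReal)) := by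
    rw [← h.measure_forall_iSup_le hμ hpos]
    simp [Pi.le_def]
  have hvoid : MeasurableSet {ω | ∀ l, x l ω ∉ A ∪ B} := by
    rw [Set.ofPred_forall]
    exact MeasurableSet.iInter fun l => (h.measurable l (hA.union hB)).compl
  have hsub : {ω | ∀ l, x l ω ∉ A ∪ B} ⊆ {ω | ∀ l, x l ω ∉ B} :=
    Set.ofPred_subset_ofPred.2 fun ω hω l hl => hω l (Or.inr hl)
  have heq : cellEvent x ε n g = {ω | ∀ l, x l ω ∉ B} \ {ω | ∀ l, x l ω ∉ A ∪ B} := by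
    ext ω
    simp only [cellEvent, Set.mem_ofPred_eq, Set.mem_sdiff, hB', Set.mem_union, not_forall,
      not_or]
    constructor
    · rintro ⟨⟨l, hl⟩, h2⟩
      exact ⟨h2, l, fun h3 => (h3.1 hl).elim⟩
    · rintro ⟨h2, l, hl⟩
      exact ⟨⟨l, by_contra fun h3 => hl ⟨h3, h2 l⟩⟩, h2⟩
  rw [heq, measure_sdiff hsub hvoid.nullMeasurableSet (measure_ne_top _ _), h.void B hB hμB,
    h.void _ (hA.union hB) (measure_union_ne_top hμA hμB), hη, measure_union hdisj hB,
    ENNReal.toReal_add hμA hμB, ← ENNReal.ofReal_sub _ (Real.exp_pos _).le,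
    ← ENNReal.ofReal_mul (Real.exp_pos _).le, mul_sub, mul_one, ← Real.exp_add]
  congr 3
  ring_nf

/-- The integrand is constant on cells, so the integral is a sum over cells; the bounds follow
termwise from `a * exp (-a) ≤ 1 - exp (-a) ≤ a` and the uniform bound on the cell masses `a`. -/
theorem tsum_measure_cellEvent_bounds (h : HasPoissonVoids P μ x) (hμ : HasFrechetTails μ) {ε : ℝ}
    (hε : 0 < ε) {n : ℕ} (hn : ((2 : ℝ) ^ n)⁻¹ ≤ ε / 2) :
    ENNReal.ofReal (Real.exp (-(2 / ε ^ 2 * (2 ^ n)⁻¹))) *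
      ∫⁻ v in orthant ι ε,
        P {ω | (fun j => ⨆ i, x i ω j) ≤ gridCorner n (gridIndex n v)} ∂μ ≤
        ∑' g, P (cellEvent x ε n g) ∧
    ∑' g, P (cellEvent x ε n g) ≤ ∫⁻ v in orthant ι ε,
      P {ω | (fun j => ⨆ i, x i ω j) ≤ gridCorner n (gridIndex n v)} ∂μ := by
  have h1 : ∫⁻ v in orthant ι ε,
      P {ω | (fun j => ⨆ i, x i ω j) ≤ gridCorner n (gridIndex n v)} ∂μ =
      ∑' g, P {ω | (fun j => ⨆ i, x i ω j) ≤ gridCorner n g} * μ (gridCell ε n g) := by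
    rw [← lintegral_map (f := fun g => P {ω | (fun j => ⨆ i, x i ω j) ≤ gridCorner n g})
      Measurable.of_discrete (measurable_gridIndex n), lintegral_countable']
    refine tsum_congr fun g => ?_
    rw [Measure.map_apply (measurable_gridIndex n) (measurableSet_singleton g),
      Measure.restrict_apply (measurable_gridIndex n (measurableSet_singleton g)),
      Set.inter_comm]
    rfl
  have hfin : ∀ g, μ (gridCell ε n g) ≠ ∞ := fun g =>
    ((measure_mono Set.inter_subset_left).trans_lt (hμ.measure_orthant_ne_top hε).lt_top).ne
  simp_rw [h1, h.measure_cellEvent hμ hε]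
  rw [← ENNReal.tsum_mul_left]
  refine ⟨ENNReal.tsum_le_tsum fun g => ?_, ENNReal.tsum_le_tsum fun g => ?_⟩
  · rw [mul_left_comm]
    gcongr
    conv_lhs => rw [← ENNReal.ofReal_toReal (hfin g), ← ENNReal.ofReal_mul (Real.exp_pos _).le]
    refine ENNReal.ofReal_le_ofReal ?_
    set a := (μ (gridCell ε n g)).toReal
    have ha : a ≤ 2 / ε ^ 2 * (2 ^ n)⁻¹ := ENNReal.toReal_le_of_le_ofReal (by positivity)
      (hμ.measure_gridCell_le hε hn g)
    have ha0 : 0 ≤ a := ENNReal.toReal_nonneg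
    have h2 : Real.exp (-(2 / ε ^ 2 * (2 ^ n)⁻¹)) ≤ Real.exp (-a) :=
      Real.exp_le_exp.2 (neg_le_neg ha)
    have h3 : a + 1 ≤ Real.exp a := Real.add_one_le_exp a
    have h4 : Real.exp (-a) * Real.exp a = 1 := by rw [← Real.exp_add]; simp
    nlinarith [mul_le_mul_of_nonneg_right h2 ha0, mul_le_mul_of_nonneg_left h3 (Real.exp_pos (-a)).le]
  · gcongr
    refine ENNReal.ofReal_le_of_le_toReal ?_
    linarith [Real.add_one_le_exp (-(μ (gridCell ε n g)).toReal)]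

theorem tendsto_lintegral_measure_le_gridCorner (h : HasPoissonVoids P μ x)
    (hμ : HasFrechetTails μ) {ε : ℝ} (hε : 0 < ε) :
    Tendsto (fun n => ∫⁻ v in orthant ι ε,
      P {ω | (fun j => ⨆ i, x i ω j) ≤ gridCorner n (gridIndex n v)} ∂μ) atTop
      (𝓝 (∫⁻ v in orthant ι ε, P {ω | (fun j => ⨆ i, x i ω j) ≤ v} ∂μ)) := by
  refine tendsto_lintegral_of_dominated_convergence (fun _ => 1) (fun n => ?_)
    (fun n => ae_of_all _ fun v => prob_le_one) ?_ (ae_of_all _ fun v => ?_)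
  · exact (Measurable.of_discrete (f := fun g =>
      P {ω | (fun j => ⨆ i, x i ω j) ≤ gridCorner n g})).comp (measurable_gridIndex n)
  · simpa using hμ.measure_orthant_ne_top hε
  · refine tendsto_measure_of_ae_tendsto_indicator_of_isFiniteMeasure atTop ?_ (fun n => ?_)
      (ae_of_all _ fun ω => ?_)
    · exact h.measurable_iSup measurableSet_Iic
    · exact h.measurable_iSup measurableSet_Iic
    · exact eventually_le_gridCorner_iff _ v

/-- Counting the grid cells for which the cell event occurs gives, in the limit of a fine grid,
the indicator of the event that a single point in the orthant dominates all the points. -/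
theorem tendsto_tsum_measure_cellEvent (h : HasPoissonVoids P μ x) (hμ : HasFrechetTails μ)
    {ε : ℝ} (hε : 0 < ε) :
    Tendsto (fun n => ∑' g, P (cellEvent x ε n g)) atTop
      (𝓝 (P {ω | ∃ l, x l ω ∈ orthant ι ε ∧ (fun j => ⨆ i, x i ω j) ≤ x l ω})) := by
  set Z : ℕ → Ω → ℝ≥0∞ := fun n ω => ∑' g, (cellEvent x ε n g).indicator 1 ω with hZ
  have hZm : ∀ n, Measurable (Z n) := fun n => Measurable.tsum fun g =>
    measurable_one.indicator (h.measurableSet_cellEvent ε n g)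
  have hZcard : ∀ n ω, Z n ω = (({g | ω ∈ cellEvent x ε n g}.encard : ℕ∞) : ℝ≥0∞) := fun n ω => by
    rw [← ENNReal.tsum_set_one, tsum_subtype {g | ω ∈ cellEvent x ε n g} (fun _ => (1 : ℝ≥0∞))]
    rfl
  have hZint : ∀ n, ∑' g, P (cellEvent x ε n g) = ∫⁻ ω, Z n ω ∂P := fun n => by
    rw [hZ, lintegral_tsum fun g =>
      (measurable_one.indicator (h.measurableSet_cellEvent ε n g)).aemeasurable]
    exact tsum_congr fun g => (lintegral_indicator_one (h.measurableSet_cellEvent ε n g)).symm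
  set C := {ω | ∃ l, x l ω ∈ orthant ι ε ∧ (fun j => ⨆ i, x i ω j) ≤ x l ω} with hC
  have hCm : MeasurableSet C := by
    rw [hC, Set.ofPred_exists]
    exact MeasurableSet.iUnion fun l => (h.measurable l (measurableSet_orthant ε)).inter
      (measurableSet_le h.measurable_iSup (h.measurable l))
  have hN : ∫⁻ ω, ((pointCount x (orthant ι ε) ω : ℕ∞) : ℝ≥0∞) ∂P ≠ ∞ := by
    have := hμ.measure_orthant_ne_top hε
    rw [← h.mean _ (measurableSet_orthant ε)] at this
    simp_rw [toENNReal_pointCount]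
    rw [lintegral_tsum fun i =>
      (measurable_one.indicator (h.measurable i (measurableSet_orthant ε))).aemeasurable]
    simpa only [lintegral_indicator_one (h.measurable _ (measurableSet_orthant ε))] using this
  simp_rw [hZint]
  rw [← lintegral_indicator_one hCm]
  refine tendsto_lintegral_of_dominated_convergence
    (fun ω => ((pointCount x (orthant ι ε) ω : ℕ∞) : ℝ≥0∞)) hZm
    (fun n => ae_of_all _ fun ω => ?_) hN ?_
  -- Each occurring cell contains a point of the orthant, so the number of such points, which has
  -- finite mean, dominates for every `n`.
  · refine (hZcard n ω).trans_le (ENat.toENNReal_le.2 ?_)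
    refine (Set.encard_le_encard ?_).trans (Set.encard_image_le (fun l => gridIndex n (x l ω)) _)
    rintro g ⟨⟨l, hl⟩, -⟩
    exact ⟨l, hl.1, hl.2⟩
  · have hNm : Measurable fun ω => ((pointCount x (orthant ι ε) ω : ℕ∞) : ℝ≥0∞) :=
      Measurable.of_discrete.comp (measurable_pointCount h.measurable (measurableSet_orthant ε))
    filter_upwards [ae_lt_top hNm hN, h.ae_bddAbove hμ] with ω hfin hbdd
    have hT : {l | x l ω ∈ orthant ι ε}.Finite := by
      rw [ENat.toENNReal_lt_top] at hfin
      exact Set.encard_lt_top_iff.1 hfin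
    set η : ι → ℝ := fun j => ⨆ i, x i ω j with hη
    have hle : ∀ l, x l ω ≤ η := fun l j => le_ciSup (hbdd j) l
    have hle_iff : ∀ w, (∀ l, x l ω ≤ w) ↔ η ≤ w := fun w =>
      ⟨fun hw j => ciSup_le fun l => hw l j, fun hw l => (hle l).trans hw⟩
    refine tendsto_const_nhds.congr' ?_
    have hev := (eventually_all_finite hT).2 fun l _ => eventually_le_gridCorner_iff η (x l ω)
    filter_upwards [hev] with n hn
    -- The orthant contains finitely many points, so for a fine mesh any of them whose cell corner
    -- dominates `η` itself dominates, hence equals, `η`. Only the cell of `η` can occur, and it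
    -- does exactly on `C`.
    have hset : {g | ω ∈ cellEvent x ε n g} = {g | g = gridIndex n η ∧ ω ∈ C} := by
      ext g
      simp only [cellEvent, Set.mem_ofPred_eq, hle_iff, hC]
      constructor
      · rintro ⟨⟨l, hl1, hl2⟩, h2⟩
        have hl2 : gridIndex n (x l ω) = g := hl2
        have h3 : η ≤ x l ω := (hn l hl1).1 (hl2 ▸ h2)
        exact ⟨by rw [← hl2, le_antisymm h3 (hle l)], l, hl1, h3⟩
      · rintro ⟨rfl, l, hl1, hl2⟩
        have h3 : x l ω = η := le_antisymm (hle l) hl2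
        exact ⟨⟨l, hl1, by rw [Set.mem_preimage, h3]; rfl⟩, le_gridCorner n η⟩
    rw [hZcard, hset]
    by_cases hω : ω ∈ C <;> simp [hω]

theorem measure_exists_orthant (h : HasPoissonVoids P μ x) (hμ : HasFrechetTails μ)
    {ε : ℝ} (hε : 0 < ε) :
    P {ω | ∃ l, x l ω ∈ orthant ι ε ∧ (fun j => ⨆ i, x i ω j) ≤ x l ω} =
      ∫⁻ v in orthant ι ε, P {ω | (fun j => ⨆ i, x i ω j) ≤ v} ∂μ := by
  have hG := h.tendsto_lintegral_measure_le_gridCorner hμ hε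
  have hδ : Tendsto (fun n : ℕ => ENNReal.ofReal (Real.exp (-(2 / ε ^ 2 * (2 ^ n)⁻¹)))) atTop
      (𝓝 1) := by
    have := ENNReal.tendsto_ofReal ((Real.continuous_exp.tendsto _).comp
      (tendsto_inv_two_pow.const_mul (2 / ε ^ 2)).neg)
    simpa using this
  have hlow := ENNReal.Tendsto.mul hδ (Or.inl one_ne_zero) hG (Or.inr ENNReal.one_ne_top)
  rw [one_mul] at hlow
  have hn : ∀ᶠ n : ℕ in atTop, ((2 : ℝ) ^ n)⁻¹ ≤ ε / 2 :=
    tendsto_inv_two_pow.eventually_le_const (half_pos hε)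
  exact tendsto_nhds_unique (h.tendsto_tsum_measure_cellEvent hμ hε)
    (tendsto_of_tendsto_of_tendsto_of_le_of_le' hlow hG
      (hn.mono fun n hn => (h.tsum_measure_cellEvent_bounds hμ hε hn).1)
      (hn.mono fun n hn => (h.tsum_measure_cellEvent_bounds hμ hε hn).2))

/-- The probability that a single point dominates all the others is the expected number of points
of an independent copy that dominate all the points. -/
theorem measure_exists_iSup_le (h : HasPoissonVoids P μ x) (hμ : HasFrechetTails μ) [SFinite μ] :
    P {ω | ∃ l, (fun j => ⨆ i, x i ω j) ≤ x l ω} =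
      ∫⁻ ω, μ {v | (fun j => ⨆ i, x i ω j) ≤ v} ∂P := by
  set η : Ω → ι → ℝ := fun ω j => ⨆ i, x i ω j with hη
  have hηm : Measurable η := h.measurable_iSup
  -- The orthants above `e m` exhaust the vectors with positive coordinates. Almost surely `η` is
  -- positive, so every vector dominating it is eventually included.
  set e : ℕ → ℝ := fun m => 1 / ((m : ℝ) + 1) with he
  have he0 : ∀ m, 0 < e m := fun m => Nat.one_div_pos_of_nat
  have hmono : Monotone fun m => orthant ι (e m) := fun m m' hmm v hv j =>
    (Nat.one_div_le_one_div hmm).trans_lt (hv j)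
  have hexh : ∀ v : ι → ℝ, (∀ j, 0 < v j) → ∃ m, v ∈ orthant ι (e m) := fun v hv => by
    have : ∀ᶠ m in atTop, ∀ j, e m < v j := eventually_all.2 fun j =>
      tendsto_one_div_add_atTop_nhds_zero_nat.eventually_lt_const (hv j)
    exact this.exists
  have hSm : ∀ m, MeasurableSet (orthant ι (e m)) := fun m => measurableSet_orthant _
  have hfub : ∀ m, ∫⁻ v in orthant ι (e m), P {ω | η ω ≤ v} ∂μ =
      ∫⁻ ω, μ (orthant ι (e m) ∩ {v | η ω ≤ v}) ∂P := fun m => by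
    have hS : MeasurableSet {p : Ω × (ι → ℝ) | η p.1 ≤ p.2} :=
      measurableSet_le (hηm.comp measurable_fst) measurable_snd
    have h1 := Measure.prod_apply (μ := P) (ν := μ.restrict (orthant ι (e m))) hS
    rw [Measure.prod_apply_symm hS] at h1
    refine h1.trans (lintegral_congr fun ω => ?_)
    rw [Measure.restrict_apply (measurable_prodMk_left hS), Set.inter_comm]
    rfl
  have hleft : P {ω | ∃ l, η ω ≤ x l ω} =
      ⨆ m, P {ω | ∃ l, x l ω ∈ orthant ι (e m) ∧ η ω ≤ x l ω} := by
    rw [← Monotone.measure_iUnion]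
    · refine measure_congr ?_
      filter_upwards [h.ae_iSup_pos hμ] with ω hω
      refine propext ?_
      change (∃ l, η ω ≤ x l ω) ↔ ω ∈ ⋃ m, {ω | ∃ l, x l ω ∈ orthant ι (e m) ∧ η ω ≤ x l ω}
      simp only [Set.mem_iUnion, Set.mem_ofPred_eq]
      constructor
      · rintro ⟨l, hl⟩
        obtain ⟨m, hm⟩ := hexh (x l ω) fun j => (hω j).trans_le (hl j)
        exact ⟨m, l, hm, hl⟩
      · rintro ⟨m, l, -, hl⟩
        exact ⟨l, hl⟩
    · intro m m' hmm
      exact Set.ofPred_subset_ofPred.2 fun ω ⟨l, h1, h2⟩ => ⟨l, hmono hmm h1, h2⟩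
  have hright : ∫⁻ ω, μ {v | η ω ≤ v} ∂P =
      ⨆ m, ∫⁻ ω, μ (orthant ι (e m) ∩ {v | η ω ≤ v}) ∂P := by
    rw [← lintegral_iSup]
    · refine lintegral_congr_ae ?_
      filter_upwards [h.ae_iSup_pos hμ] with ω hω
      rw [← Monotone.measure_iUnion fun m m' hmm => Set.inter_subset_inter_left _ (hmono hmm),
        ← Set.iUnion_inter]
      congr 1
      refine (Set.inter_eq_right.2 fun v hv => Set.mem_iUnion.2 (hexh v fun j => ?_)).symm
      exact (hω j).trans_le (hv j)
    · intro m
      have hS : MeasurableSet {p : Ω × (ι → ℝ) | p.2 ∈ orthant ι (e m) ∧ η p.1 ≤ p.2} :=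
        (measurable_snd (hSm m)).inter (measurableSet_le (hηm.comp measurable_fst) measurable_snd)
      exact measurable_measure_prodMk_left hS
    · intro m m' hmm ω
      exact measure_mono (Set.inter_subset_inter_left _ (hmono hmm))
  rw [hleft, hright]
  exact iSup_congr fun m => (h.measure_exists_orthant hμ (he0 m)).trans (hfub m)

end HasPoissonVoids

/-! ### Inclusion–exclusion for the mass above a vector. -/

section InclusionExclusion

variable {ι : Type*} [Fintype ι] [Nonempty ι]

theorem indicator_forall_lt_eq (y v : ι → ℝ) :
    {v : ι → ℝ | ∀ j, y j < v j}.indicator (1 : (ι → ℝ) → ℝ) v =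
      ∑ J : Finset ι, -((-1 : ℝ) ^ J.card * (exceedSet J y).indicator 1 v) := by
  classical
  have h1 : ∀ J : Finset ι, ∏ j ∈ J, (1 - {v : ι → ℝ | y j < v j}.indicator (1 : (ι → ℝ) → ℝ) v) =
      1 - (exceedSet J y).indicator 1 v := by
    intro J
    by_cases hv : v ∈ exceedSet J y
    · obtain ⟨j, hj, hjv⟩ := id hv
      rw [Finset.prod_eq_zero hj (by simp [hjv])]
      simp [hv]
    · rw [Finset.prod_eq_one fun j hj => ?_]
      · simp [hv]
      · have : ¬ y j < v j := fun h => hv ⟨j, hj, h⟩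
        simp [this]
  have h2 : {v : ι → ℝ | ∀ j, y j < v j}.indicator (1 : (ι → ℝ) → ℝ) v =
      ∏ j : ι, (1 - (1 - {v : ι → ℝ | y j < v j}.indicator (1 : (ι → ℝ) → ℝ) v)) := by
    by_cases hv : ∀ j, y j < v j
    · simp [hv]
    · obtain ⟨j, hj⟩ := not_forall.1 hv
      rw [Finset.prod_eq_zero (Finset.mem_univ j) (by simp [hj])]
      simp [hv]
  -- Nonemptiness of `ι` enters here. The constant terms cancel before integration, leaving only
  -- indicators of sets of finite mass, even when `μ` is infinite.
  have h3 : ∑ J : Finset ι, (-1 : ℝ) ^ J.card = 0 := by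
    have := Finset.prod_add (fun _ : ι => (-1 : ℝ)) (fun _ => 1) Finset.univ
    simpa using this.symm
  rw [h2, Finset.prod_sub]
  simp only [Finset.prod_const_one, mul_one, Finset.powerset_univ, h1]
  simp only [mul_sub, mul_one, Finset.sum_sub_distrib, h3, zero_sub, Finset.sum_neg_distrib]

theorem HasFrechetTails.measureReal_le_eq {μ : Measure (ι → ℝ)} (hμ : HasFrechetTails μ)
    {y : ι → ℝ} (hy : ∀ j, 0 < y j) :
    μ.real {v | y ≤ v} = ∑ J : Finset ι, (-1 : ℝ) ^ J.card * (-μ.real (exceedSet J y)) := by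
  have h1 : μ {v | y ≤ v} = μ {v | ∀ j, y j < v j} := by
    refine measure_congr ?_
    have : ∀ᵐ v ∂μ, ∀ j, v j ≠ y j := ae_all_iff.2 fun j => by
      simpa [ae_iff] using hμ.measure_coord_eq j (hy j)
    filter_upwards [this] with v hv
    refine propext ?_
    exact ⟨fun h j => lt_of_le_of_ne (h j) (hv j).symm, fun h j => (h j).le⟩
  have hm : MeasurableSet {v : ι → ℝ | ∀ j, y j < v j} := by
    rw [Set.ofPred_forall]
    exact MeasurableSet.iInter fun j => measurableSet_coord_lt j _
  rw [measureReal_def, h1, ← measureReal_def, ← integral_indicator_one hm]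
  simp_rw [indicator_forall_lt_eq]
  rw [integral_finsetSum]
  · refine Finset.sum_congr rfl fun J _ => ?_
    rw [integral_neg, integral_const_mul, integral_indicator_one (measurableSet_exceedSet J y),
      mul_neg]
  · intro J _
    refine Integrable.neg (Integrable.const_mul ?_ _)
    exact (integrable_indicator_iff (measurableSet_exceedSet J y)).2
      (integrableOn_const (hμ.measure_exceedSet_ne_top fun j _ => hy j))

end InclusionExclusion

/-! ### The concurrence formula for point processes. -/

namespace HasPoissonVoids

variable {Ω ι : Type*} [MeasurableSpace Ω] [Fintype ι] {P : Measure Ω}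
  [IsProbabilityMeasure P] {μ : Measure (ι → ℝ)} {x : ℕ → Ω → ι → ℝ}

theorem measureReal_iSup_le_iSup (h : HasPoissonVoids P μ x) (hμ : HasFrechetTails μ)
    (J : Finset ι) : ∀ᵐ ω' ∂P, P.real {ω | ∀ j ∈ J, ⨆ i, x i ω j ≤ ⨆ i, x i ω' j} =
      Real.exp (-μ.real (exceedSet J fun j => ⨆ i, x i ω' j)) := by
  filter_upwards [h.ae_iSup_pos hμ] with ω' hω'
  rw [measureReal_def, h.measure_forall_iSup_le hμ (y := fun j => ⨆ i, x i ω' j) fun j _ => hω' j,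
    ENNReal.toReal_ofReal (Real.exp_pos _).le]
  rfl

theorem integrable_inv_iSup (h : HasPoissonVoids P μ x) (hμ : HasFrechetTails μ) (j : ι) :
    Integrable (fun ω => (⨆ i, x i ω j)⁻¹) P := by
  have hm : Measurable fun ω => ⨆ i, x i ω j := (measurable_pi_apply j).comp h.measurable_iSup
  refine ⟨hm.inv.aestronglyMeasurable, ?_⟩
  rw [hasFiniteIntegral_iff_ofReal ((h.ae_iSup_pos hμ).mono fun ω hω => (inv_pos.2 (hω j)).le),
    h.lintegral_inv_iSup hμ j]
  exact ENNReal.one_lt_top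

theorem integral_inv_iSup (h : HasPoissonVoids P μ x) (hμ : HasFrechetTails μ) (j : ι) :
    ∫ ω, (⨆ i, x i ω j)⁻¹ ∂P = 1 := by
  rw [integral_eq_lintegral_of_nonneg_ae
    ((h.ae_iSup_pos hμ).mono fun ω hω => (inv_pos.2 (hω j)).le)
    (h.integrable_inv_iSup hμ j).aestronglyMeasurable, h.lintegral_inv_iSup hμ j]
  simp

omit [Fintype ι] in
theorem measurable_measureReal_iSup_le (h : HasPoissonVoids P μ x) (J : Finset ι) :
    Measurable fun y : ι → ℝ => P.real {ω | ∀ j ∈ J, ⨆ i, x i ω j ≤ y j} := by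
  have hS : MeasurableSet {p : (ι → ℝ) × Ω | ∀ j ∈ J, ⨆ i, x i p.2 j ≤ p.1 j} := by
    have : {p : (ι → ℝ) × Ω | ∀ j ∈ J, ⨆ i, x i p.2 j ≤ p.1 j} =
        ⋂ j ∈ J, {p | ⨆ i, x i p.2 j ≤ p.1 j} := by
      ext p
      simp
    rw [this]
    refine J.measurableSet_biInter fun j _ => measurableSet_le ?_ ?_
    · exact ((measurable_pi_apply j).comp h.measurable_iSup).comp measurable_snd
    · exact (measurable_pi_apply j).comp measurable_fst
  exact (measurable_measure_prodMk_left hS).ennreal_toReal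

theorem integrable_log_measureReal (h : HasPoissonVoids P μ x) (hμ : HasFrechetTails μ)
    (J : Finset ι) : Integrable (fun ω' =>
      Real.log (P.real {ω | ∀ j ∈ J, ⨆ i, x i ω j ≤ ⨆ i, x i ω' j})) P := by
  have hint : Integrable (fun ω' => ∑ j ∈ J, (⨆ i, x i ω' j)⁻¹) P :=
    integrable_finsetSum _ fun j _ => h.integrable_inv_iSup hμ j
  refine hint.mono' ?_ ?_
  · exact ((h.measurable_measureReal_iSup_le J).comp
      h.measurable_iSup).log.aestronglyMeasurable
  · filter_upwards [h.measureReal_iSup_le_iSup hμ J, h.ae_iSup_pos hμ] with ω' h1 h2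
    -- The absolute logarithm is the mass of the exceedance set, at most the sum of the integrable
    -- reciprocals of the suprema over `J`.
    rw [h1, Real.log_exp, norm_neg, Real.norm_of_nonneg measureReal_nonneg]
    refine ENNReal.toReal_le_of_le_ofReal
      (Finset.sum_nonneg fun j _ => (inv_pos.2 (h2 j)).le) ?_
    rw [ENNReal.ofReal_sum_of_nonneg fun j _ => (inv_pos.2 (h2 j)).le]
    exact hμ.measure_exceedSet_le fun j _ => h2 j

theorem measureReal_exists_iSup_le [Nonempty ι] [SFinite μ] (h : HasPoissonVoids P μ x)
    (hμ : HasFrechetTails μ) : P.real {ω | ∃ l, (fun j => ⨆ i, x i ω j) ≤ x l ω} =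
      ∑ J : Finset ι, (-1 : ℝ) ^ J.card *
        ∫ ω', Real.log (P.real {ω | ∀ j ∈ J, ⨆ i, x i ω j ≤ ⨆ i, x i ω' j}) ∂P := by
  have hS : MeasurableSet {p : Ω × (ι → ℝ) | (fun j => ⨆ i, x i p.1 j) ≤ p.2} :=
    measurableSet_le (h.measurable_iSup.comp measurable_fst) measurable_snd
  have hSm : Measurable fun ω => μ {v | (fun j => ⨆ i, x i ω j) ≤ v} :=
    measurable_measure_prodMk_left hS
  have hfin : ∀ᵐ ω ∂P, μ {v | (fun j => ⨆ i, x i ω j) ≤ v} < ∞ := by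
    refine ae_lt_top hSm ?_
    have := h.measure_exists_iSup_le hμ
    exact (this.symm.trans_lt (measure_lt_top _ _)).ne
  rw [measureReal_def, h.measure_exists_iSup_le hμ,
    ← integral_toReal hSm.aemeasurable hfin]
  simp_rw [← integral_const_mul]
  rw [← integral_finsetSum _ fun J _ => (h.integrable_log_measureReal hμ J).const_mul _]
  refine integral_congr_ae ?_
  have hJ : ∀ᵐ ω' ∂P, ∀ J : Finset ι, P.real {ω | ∀ j ∈ J, ⨆ i, x i ω j ≤ ⨆ i, x i ω' j} =
      Real.exp (-μ.real (exceedSet J fun j => ⨆ i, x i ω' j)) :=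
    ae_all_iff.2 fun J => h.measureReal_iSup_le_iSup hμ J
  filter_upwards [hJ, h.ae_iSup_pos hμ] with ω' h1 h2
  refine (hμ.measureReal_le_eq h2).trans (Finset.sum_congr rfl fun J _ => ?_)
  rw [h1, Real.log_exp]

theorem integral_log_measureReal_singleton (h : HasPoissonVoids P μ x) (hμ : HasFrechetTails μ)
    (j : ι) : ∫ ω', Real.log (P.real {ω | ∀ j' ∈ ({j} : Finset ι),
      ⨆ i, x i ω j' ≤ ⨆ i, x i ω' j'}) ∂P = -1 := by
  rw [← h.integral_inv_iSup hμ j, ← integral_neg]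
  refine integral_congr_ae ?_
  filter_upwards [h.ae_iSup_pos hμ] with ω' hω'
  simp only [Finset.mem_singleton, forall_eq]
  rw [measureReal_def, h.measure_iSup_le hμ j (hω' j), ENNReal.toReal_ofReal (Real.exp_pos _).le,
    Real.log_exp]

end HasPoissonVoids

/-! ### Application to spectral representations. -/

namespace IsSpectralRepresentation

variable {Ω T : Type*} [MeasurableSpace Ω] [TopologicalSpace T] {P : Measure Ω}
  [IsProbabilityMeasure P] {ζ : ℕ → Ω → ℝ} {Y : ℕ → Ω → T → ℝ} {k : ℕ}

/-- The intensity of the points `ζ i • Y i` restricted to finitely many sites. -/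
noncomputable def siteIntensity (P : Measure Ω) (Y : ℕ → Ω → T → ℝ) (s : Fin k → T) :
    Measure (Fin k → ℝ) :=
  (frechetIntensity.prod (P.map fun ω j => Y 0 ω (s j))).map fun p j => p.1 * p.2 j

instance (s : Fin k → T) : SFinite (siteIntensity P Y s) := by
  unfold siteIntensity
  infer_instance

theorem hasPoissonVoids (h : IsSpectralRepresentation P ζ Y) (s : Fin k → T) :
    HasPoissonVoids P (siteIntensity P Y s) (fun i ω j => ζ i ω * Y i ω (s j)) := by
  have hr : Measurable fun (y : T → ℝ) (j : Fin k) => y (s j) := by fun_prop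
  have hr' : Measurable fun (y : ℕ → T → ℝ) (i : ℕ) (j : Fin k) => y i (s j) := by fun_prop
  have hmark := h.poisson.hasPoissonVoids_marked (V := fun i ω j => Y i ω (s j))
    (fun i => hr.comp (h.measurable i)) (h.indep_copies.comp (fun _ y j => y (s j)) fun _ => hr)
    (fun i => (h.ident_copies i).comp hr) (h.indep.comp measurable_id hr')
  exact hmark.map (f := fun (p : ℝ × (Fin k → ℝ)) j => p.1 * p.2 j) (by fun_prop)

theorem hasFrechetTails (h : IsSpectralRepresentation P ζ Y) (s : Fin k → T) :
    HasFrechetTails (siteIntensity P Y s) := by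
  intro j u hu
  have hr : Measurable fun (ω : Ω) (j : Fin k) => Y 0 ω (s j) :=
    measurable_pi_lambda _ fun j => (measurable_pi_apply (s j)).comp (h.measurable 0)
  have hf : Measurable fun (p : ℝ × (Fin k → ℝ)) j => p.1 * p.2 j := by fun_prop
  have hS := hf (measurableSet_coord_lt j u)
  rw [siteIntensity, Measure.map_apply hf (measurableSet_coord_lt j u),
    Measure.prod_apply_symm hS, lintegral_map (measurable_measure_prodMk_right hS) hr]
  have h1 : ∀ ω, frechetIntensity ((fun z => (z, fun j => Y 0 ω (s j))) ⁻¹'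
      ((fun (p : ℝ × (Fin k → ℝ)) j => p.1 * p.2 j) ⁻¹' {v | u < v j})) =
      ENNReal.ofReal (u⁻¹ * Y 0 ω (s j)) := fun ω =>
    frechetIntensity_lt_mul hu (h.nonneg 0 ω (s j))
  rw [lintegral_congr h1, ← ofReal_integral_eq_lintegral_ofReal ((h.mean 0 (s j)).1.const_mul _)
    (ae_of_all _ fun ω => mul_nonneg (inv_pos.2 hu).le (h.nonneg 0 ω (s j))), integral_const_mul,
    (h.mean 0 (s j)).2, mul_one]

theorem belowProb_pos_and_integrable_log (h : IsSpectralRepresentation P ζ Y) (s : Fin k → T)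
    (J : Finset (Fin k)) :
    (∀ᵐ ω' ∂P, 0 < belowProb P (maxProcess ζ Y) s J (maxProcess ζ Y ω')) ∧
      Integrable
        (fun ω' => Real.log (belowProb P (maxProcess ζ Y) s J (maxProcess ζ Y ω'))) P := by
  have hv := h.hasPoissonVoids s
  have hμ := h.hasFrechetTails s
  refine ⟨?_, hv.integrable_log_measureReal hμ J⟩
  filter_upwards [hv.measureReal_iSup_le_iSup hμ J] with ω' hω'
  exact hω'.trans_gt (Real.exp_pos _)

/-- Almost surely the suprema bound every term, so attaining them at all sites is the same as
dominating them. -/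
theorem concurrenceProb_eq (h : IsSpectralRepresentation P ζ Y) [NeZero k] (s : Fin k → T) :
    concurrenceProb P ζ Y s = ∑ J : Finset (Fin k), (-1 : ℝ) ^ J.card *
      ∫ ω', Real.log (belowProb P (maxProcess ζ Y) s J (maxProcess ζ Y ω')) ∂P := by
  have hv := h.hasPoissonVoids s
  have hμ := h.hasFrechetTails s
  refine Eq.trans ?_ (hv.measureReal_exists_iSup_le hμ)
  refine measureReal_congr ?_
  filter_upwards [hv.ae_bddAbove hμ] with ω hω
  refine propext ?_
  change (∃ l, ∀ j, maxProcess ζ Y ω (s j) = ζ l ω * Y l ω (s j)) ↔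
    ∃ l, ∀ j, ⨆ i, ζ i ω * Y i ω (s j) ≤ ζ l ω * Y l ω (s j)
  exact exists_congr fun l => forall_congr' fun j =>
    ⟨fun hl => hl.le, fun hl => le_antisymm hl (le_ciSup (hω j) l)⟩

omit [TopologicalSpace T] in
theorem integral_log_belowProb_empty (s : Fin k → T) :
    ∫ ω', Real.log (belowProb P (maxProcess ζ Y) s ∅ (maxProcess ζ Y ω')) ∂P = 0 := by
  simp [belowProb]

theorem concurrenceProb_eq_sum (h : IsSpectralRepresentation P ζ Y) [NeZero k] (s : Fin k → T) :
    concurrenceProb P ζ Y s = ∑ r ∈ Finset.Icc 1 k, (-1 : ℝ) ^ r *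
      ∑ J ∈ Finset.powersetCard r (Finset.univ : Finset (Fin k)),
        ∫ ω', Real.log (belowProb P (maxProcess ζ Y) s J (maxProcess ζ Y ω')) ∂P := by
  -- Subsets are sorted by size; the empty one contributes `log 1 = 0`, so the sum starts at `r =
  -- 1`.
  rw [h.concurrenceProb_eq s, ← Finset.powerset_univ, Finset.sum_powerset, Finset.card_univ,
    Fintype.card_fin, Finset.sum_range_succ', Finset.powersetCard_zero, Finset.sum_singleton,
    integral_log_belowProb_empty, mul_zero, add_zero, Finset.sum_bij (fun r _ => r + 1)]
  · intro r hr
    simp only [Finset.mem_range] at hr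
    simp only [Finset.mem_Icc]
    omega
  · intro a _ b _ hab
    omega
  · intro r hr
    simp only [Finset.mem_Icc] at hr
    exact ⟨r - 1, by simp only [Finset.mem_range]; omega, by omega⟩
  · intro r _
    rw [Finset.mul_sum]
    exact Finset.sum_congr rfl fun J hJ => by rw [(Finset.mem_powersetCard.1 hJ).2]

theorem concurrenceProb_pair (h : IsSpectralRepresentation P ζ Y) (s₁ s₂ : T) :
    concurrenceProb P ζ Y ![s₁, s₂] =
      2 + ∫ ω', Real.log (P.real {ω | maxProcess ζ Y ω s₁ ≤ maxProcess ζ Y ω' s₁ ∧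
        maxProcess ζ Y ω s₂ ≤ maxProcess ζ Y ω' s₂}) ∂P := by
  have hone : ∀ j : Fin 2, ∫ ω', Real.log (belowProb P (maxProcess ζ Y) ![s₁, s₂] {j}
      (maxProcess ζ Y ω')) ∂P = -1 := fun j =>
    (h.hasPoissonVoids ![s₁, s₂]).integral_log_measureReal_singleton
      (h.hasFrechetTails ![s₁, s₂]) j
  have huniv : (Finset.univ : Finset (Finset (Fin 2))) = {∅, {0}, {1}, {0, 1}} := by decide
  have htwo : ∀ ω', belowProb P (maxProcess ζ Y) ![s₁, s₂] {0, 1} (maxProcess ζ Y ω') =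
      P.real {ω | maxProcess ζ Y ω s₁ ≤ maxProcess ζ Y ω' s₁ ∧
        maxProcess ζ Y ω s₂ ≤ maxProcess ζ Y ω' s₂} := fun ω' => by
    simp [belowProb]
  -- Each singleton contributes `(-1) * (-1) = 1`, whence the constant `2`.
  rw [h.concurrenceProb_eq, huniv, Finset.sum_insert (by decide), Finset.sum_insert (by decide),
    Finset.sum_insert (by decide), Finset.sum_singleton, hone, hone, integral_log_belowProb_empty]
  simp_rw [htwo]
  rw [Finset.card_singleton, Finset.card_singleton, Finset.card_pair (by decide)]
  ring

theorem measurable_belowProb (h : IsSpectralRepresentation P ζ Y) (s : Fin k → T)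
    (J : Finset (Fin k)) : Measurable (belowProb P (maxProcess ζ Y) s J) := by
  have hr : Measurable fun (y : T → ℝ) (j : Fin k) => y (s j) := by fun_prop
  exact ((h.hasPoissonVoids s).measurable_measureReal_iSup_le J).comp hr

variable {Ω' : Type*} [MeasurableSpace Ω'] {P' : Measure Ω'} [IsProbabilityMeasure P']
  {ζ' : ℕ → Ω' → ℝ} {Y' : ℕ → Ω' → T → ℝ}

/-- In the concurrence formula the inner probability is a functional of the law of `η`, and the
outer expectation integrates a measurable function of the path against that same law. -/
theorem concurrenceProb_eq_of_identDistrib (h : IsSpectralRepresentation P ζ Y)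
    (h' : IsSpectralRepresentation P' ζ' Y')
    (hid : IdentDistrib (maxProcess ζ Y) (maxProcess ζ' Y') P P') [NeZero k] (s : Fin k → T) :
    concurrenceProb P ζ Y s = concurrenceProb P' ζ' Y' s := by
  have hbelow : ∀ J, belowProb P (maxProcess ζ Y) s J = belowProb P' (maxProcess ζ' Y') s J := by
    intro J
    funext y
    have hS : MeasurableSet {w : T → ℝ | ∀ j ∈ J, w (s j) ≤ y (s j)} := by
      have : {w : T → ℝ | ∀ j ∈ J, w (s j) ≤ y (s j)} = ⋂ j ∈ J, {w | w (s j) ≤ y (s j)} := by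
        ext w
        simp
      rw [this]
      exact J.measurableSet_biInter fun j _ =>
        measurableSet_le (measurable_pi_apply _) measurable_const
    exact congrArg ENNReal.toReal (hid.measure_mem_eq hS)
  rw [h.concurrenceProb_eq s, h'.concurrenceProb_eq s]
  refine Finset.sum_congr rfl fun J _ => ?_
  rw [← hbelow J]
  congr 1
  exact (hid.comp (h.measurable_belowProb s J).log).integral_eq

end IsSpectralRepresentation

theorem theorem3 {d : ℕ} {K : Set (EuclideanSpace ℝ (Fin d))} (hK : IsCompact K)
    {Ω : Type*} [MeasurableSpace Ω] (P : Measure Ω) [IsProbabilityMeasure P]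
    (ζ : ℕ → Ω → ℝ) (Y : ℕ → Ω → K → ℝ) (h : IsSpectralRepresentation P ζ Y) :
    -- the formula for `p(s_1, …, s_k)`; the outer integral is over an independent copy of `η`
    (∀ (k : ℕ), 2 ≤ k → ∀ s : Fin k → K,
      (∀ J : Finset (Fin k),
        (∀ᵐ ω' ∂P, 0 < belowProb P (maxProcess ζ Y) s J (maxProcess ζ Y ω')) ∧
        Integrable
          (fun ω' => Real.log (belowProb P (maxProcess ζ Y) s J (maxProcess ζ Y ω'))) P) ∧
      concurrenceProb P ζ Y s =
        ∑ r ∈ Finset.Icc 1 k, (-1 : ℝ) ^ r *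
          ∑ J ∈ Finset.powersetCard r (Finset.univ : Finset (Fin k)),
            ∫ ω', Real.log (belowProb P (maxProcess ζ Y) s J (maxProcess ζ Y ω')) ∂P) ∧
    -- the case `k = 2`
    (∀ s₁ s₂ : K,
      concurrenceProb P ζ Y ![s₁, s₂] =
        2 + ∫ ω', Real.log (P.real {ω | maxProcess ζ Y ω s₁ ≤ maxProcess ζ Y ω' s₁ ∧
          maxProcess ζ Y ω s₂ ≤ maxProcess ζ Y ω' s₂}) ∂P) ∧
    -- `p` depends only on the law of the process `η`
    (∀ (Ω' : Type*) [MeasurableSpace Ω'] (P' : Measure Ω') [IsProbabilityMeasure P']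
      (ζ' : ℕ → Ω' → ℝ) (Y' : ℕ → Ω' → K → ℝ), IsSpectralRepresentation P' ζ' Y' →
      IdentDistrib (maxProcess ζ Y) (maxProcess ζ' Y') P P' →
      ∀ (k : ℕ), 2 ≤ k → ∀ s : Fin k → K,
        concurrenceProb P ζ Y s = concurrenceProb P' ζ' Y' s) := by
  refine ⟨fun k hk s => ?_, h.concurrenceProb_pair, fun Ω' _ P' _ ζ' Y' h' hid k hk s => ?_⟩
  · have : NeZero k := ⟨by omega⟩
    exact ⟨h.belowProb_pos_and_integrable_log s, h.concurrenceProb_eq_sum s⟩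
  · have : NeZero k := ⟨by omega⟩
    exact h.concurrenceProb_eq_of_identDistrib h' hid s
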